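/- Theorem 5.3. Let $F:(\mathbb{R}^m\times\mathbb{R}^n,0)\to(\mathbb{R}^p,0)$ be the germ at the origin of a $C^\infty$ map, and let $\hat y_0\in\mathbb{R}[[x]]^{n}$, $x=(x_1,\dots,x_m)$, be a vector of formal power series without constant terms that is a formal solution of $F(x,y)=0$: $\hat F(x,\hat y_0(x))=0$ in $\mathbb{R}[[x]]^p$, where $\hat F\in\mathbb{R}[[x,y]]^p$ is the Taylor series of $F$ at the origin. Let $y_0:(\mathbb{R}^m,0)\to(\mathbb{R}^n,0)$ be the germ of a $C^\infty$ map whose Taylor series at $0$ is $\hat y_0$. Let $F'_y(x,y_0)$ denote the $p\times n$ matrix of partial derivatives of $F$ in the variables $y$, evaluated at $(x,y_0(x))$, and put $d(x)=\det\big(F'_y(x,y_0)\,F'_y(x,y_0)^T\big)$. Let $\mathfrak m$ be the maximal ideal of the ring $C^\infty(\mathbb{R}^m,0)$ of germs at $0$ of real $C^\infty$ functions, and $\mathfrak m^\infty=\bigcap_{k\ge 0}\mathfrak m^k$. 1. The condition $d\cdot\mathfrak m^\infty=\mathfrak m^\infty$ is equivalent to the Łojasiewicz condition: there are constants $C,\delta>0$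 such that $|d(x)|\ge C\,\mathrm{dist}(x,0)^\delta$ for all $x$ in some neighbourhood of $0$. 2. If $d\cdot\mathfrak m^\infty=\mathfrak m^\infty$, then there exists the germ of a $C^\infty$ map $y:(\mathbb{R}^m,0)\to(\mathbb{R}^n,0)$ whose Taylor series at $0$ is exactly $\hat y_0$ and which satisfies $F(x,y(x))=0$ for all $x$ in a neighbourhood of $0$. -/

import Mathlib

open Filter
open scoped Topology ContDiff

namespace SmoothEq

/-- `f` represents a `C^∞` germ at `a`: it is `C^∞` on some neighbourhood of `a`.
(`ContDiffAt ℝ ∞ f a` alone would allow a neighbourhood that shrinks with the order.) -/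
def SmoothNear {V W : Type*} [NormedAddCommGroup V] [NormedSpace ℝ V]
    [NormedAddCommGroup W] [NormedSpace ℝ W] (f : V → W) (a : V) : Prop :=
  ∀ᶠ x in 𝓝 a, ContDiffAt ℝ ∞ f x

/-- The ring `C^∞(ℝ^m, 0)` of germs at the origin of real `C^∞` functions on `ℝ^m`. -/
def SmoothGerm (m : ℕ) : Subring (Germ (𝓝 (0 : EuclideanSpace ℝ (Fin m))) ℝ) where
  carrier := {g | ∃ f : EuclideanSpace ℝ (Fin m) → ℝ, SmoothNear f 0 ∧ (f : Germ _ ℝ) = g}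
  mul_mem' := by
    rintro _ _ ⟨f, hf, rfl⟩ ⟨g, hg, rfl⟩
    exact ⟨f * g, by filter_upwards [hf, hg] with x h1 h2 using h1.mul h2, rfl⟩
  one_mem' := ⟨1, Eventually.of_forall fun _ => contDiffAt_const, rfl⟩
  add_mem' := by
    rintro _ _ ⟨f, hf, rfl⟩ ⟨g, hg, rfl⟩
    exact ⟨f + g, by filter_upwards [hf, hg] with x h1 h2 using h1.add h2, rfl⟩
  zero_mem' := ⟨0, Eventually.of_forall fun _ => contDiffAt_const, rfl⟩
  neg_mem' := by
    rintro _ ⟨f, hf, rfl⟩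
    exact ⟨-f, by filter_upwards [hf] with x h1 using h1.neg, rfl⟩

/-- The germ of a function that is smooth near the origin. -/
def SmoothGerm.mk {m : ℕ} (f : EuclideanSpace ℝ (Fin m) → ℝ) (hf : SmoothNear f 0) :
    SmoothGerm m :=
  ⟨(f : Germ _ ℝ), f, hf, rfl⟩

/-- The maximal ideal `𝔪` of `C^∞(ℝ^m, 0)`: the germs that vanish at the origin. -/
noncomputable def maxIdeal (m : ℕ) : Ideal (SmoothGerm m) :=
  RingHom.ker (Germ.valueRingHom.comp (SmoothGerm m).subtype)

/-- The ideal `𝔪^∞ = ⋂ₖ 𝔪^k`. -/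
noncomputable def maxIdealInfty (m : ℕ) : Ideal (SmoothGerm m) :=
  ⨅ k : ℕ, maxIdeal m ^ k

/-- The Taylor series at the origin of `f : V → ℝ` in the coordinates given by the finite family
of vectors `e` (in use: the standard basis). The coefficient of `X^α` is `(1/α!) ∂^α f(0)`, the
mixed derivative being the value of the `|α|`-th derivative on the vectors `e i`, each repeated
`α i` times; by symmetry, the order in which they are listed is immaterial for smooth `f`. -/
noncomputable def taylorSeries {σ V : Type*} [NormedAddCommGroup V] [NormedSpace ℝ V]
    (e : σ → V) (f : V → ℝ) : MvPowerSeries σ ℝ := fun α =>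
  (α.prod fun _ k => (k.factorial : ℝ))⁻¹ *
    iteratedFDeriv ℝ α.toMultiset.toList.length f 0 (fun k => e (α.toMultiset.toList.get k))

/-- The standard basis of `ℝ^m`. -/
noncomputable def stdBasis (m : ℕ) : Fin m → EuclideanSpace ℝ (Fin m) :=
  fun i => EuclideanSpace.single i (1 : ℝ)

/-- The standard basis of `ℝ^m × ℝ^n`. -/
noncomputable def stdBasisProd (m n : ℕ) :
    Fin m ⊕ Fin n → EuclideanSpace ℝ (Fin m) × EuclideanSpace ℝ (Fin n) :=
  Sum.elim (fun i => (stdBasis m i, 0)) (fun j => (0, stdBasis n j))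

/-- `ŷ ∈ ℝ[[x]]^n`, without constant term, is a formal solution of `F(x, y) = 0`: substituting it
for `y` in the Taylor series at the origin of each component of `F` gives `0 ∈ ℝ[[x]]`. -/
def IsFormalSolution {m n p : ℕ}
    (F : EuclideanSpace ℝ (Fin m) × EuclideanSpace ℝ (Fin n) → EuclideanSpace ℝ (Fin p))
    (ŷ : Fin n → MvPowerSeries (Fin m) ℝ) : Prop :=
  (∀ j, MvPowerSeries.constantCoeff (ŷ j) = 0) ∧
  ∀ i, MvPowerSeries.subst (Sum.elim (fun k => MvPowerSeries.X k) ŷ)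
    (taylorSeries (stdBasisProd m n) fun z => F z i) = 0

/-- `y` represents the germ of a `C^∞` map `(ℝ^m, 0) → (ℝ^n, 0)` with Taylor series `ŷ`. -/
def IsRealization {m n : ℕ} (ŷ : Fin n → MvPowerSeries (Fin m) ℝ)
    (y : EuclideanSpace ℝ (Fin m) → EuclideanSpace ℝ (Fin n)) : Prop :=
  SmoothNear y 0 ∧ y 0 = 0 ∧ ∀ j, taylorSeries (stdBasis m) (fun x => y x j) = ŷ j

/-- The `p × n` matrix `F'_y(x, y₀(x))` of partial derivatives of `F` in the variables `y`. -/
noncomputable def jacobianY {m n p : ℕ}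
    (F : EuclideanSpace ℝ (Fin m) × EuclideanSpace ℝ (Fin n) → EuclideanSpace ℝ (Fin p))
    (y₀ : EuclideanSpace ℝ (Fin m) → EuclideanSpace ℝ (Fin n))
    (x : EuclideanSpace ℝ (Fin m)) : Matrix (Fin p) (Fin n) ℝ :=
  Matrix.of fun i j => fderiv ℝ (fun y => F (x, y)) (y₀ x) (stdBasis n j) i

/-- The function `x ↦ det (F'_y(x, y₀(x)) F'_y(x, y₀(x))ᵀ)`. -/
noncomputable def gramDet {m n p : ℕ}
    (F : EuclideanSpace ℝ (Fin m) × EuclideanSpace ℝ (Fin n) → EuclideanSpace ℝ (Fin p))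
    (y₀ : EuclideanSpace ℝ (Fin m) → EuclideanSpace ℝ (Fin n))
    (x : EuclideanSpace ℝ (Fin m)) : ℝ :=
  (jacobianY F y₀ x * (jacobianY F y₀ x).transpose).det

theorem smoothNear_gramDet {m n p : ℕ}
    {F : EuclideanSpace ℝ (Fin m) × EuclideanSpace ℝ (Fin n) → EuclideanSpace ℝ (Fin p)}
    {y₀ : EuclideanSpace ℝ (Fin m) → EuclideanSpace ℝ (Fin n)}
    (hF : SmoothNear F 0) (hy : SmoothNear y₀ 0) (h0 : y₀ 0 = 0) :
    SmoothNear (gramDet F y₀) 0 := by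
  have hc : Tendsto (fun x => (x, y₀ x)) (𝓝 0) (𝓝 0) := by
    have h := (continuousAt_id (x := (0 : EuclideanSpace ℝ (Fin m)))).prodMk
      hy.self_of_nhds.continuousAt
    simp only [ContinuousAt, id, h0] at h
    exact h
  have hent : ∀ᶠ x in 𝓝 (0 : EuclideanSpace ℝ (Fin m)), ∀ i j,
      ContDiffAt ℝ ∞ (fun x => jacobianY F y₀ x i j) x := by
    filter_upwards [hc.eventually hF, hy] with x h1 h2 i j
    have h3 : ContDiffAt ℝ ∞ (fun x => fderiv ℝ (fun y => F (x, y)) (y₀ x)) x :=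
      ContDiffAt.fderiv (f := fun x y => F (x, y)) (n := ∞) h1 h2 (by simp)
    have h4 : ContDiffAt ℝ ∞
        (fun x => fderiv ℝ (fun y => F (x, y)) (y₀ x) (stdBasis n j)) x :=
      h3.clm_apply contDiffAt_const
    exact (EuclideanSpace.proj (𝕜 := ℝ) i).contDiff.contDiffAt.comp x h4
  filter_upwards [hent] with x h
  have : gramDet F y₀ = fun x => ∑ s : Equiv.Perm (Fin p), (Equiv.Perm.sign s : ℝ) *
      ∏ i, ∑ j, jacobianY F y₀ x (s i) j * jacobianY F y₀ x i j := by
    funext x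
    simp [gramDet, Matrix.det_apply', Matrix.mul_apply]
  rw [this]
  refine ContDiffAt.sum fun s _ => contDiffAt_const.mul (contDiffAt_prod fun i _ => ?_)
  exact ContDiffAt.sum fun j _ => (h _ _).mul (h _ _)

/-- The Łojasiewicz condition at the origin: `|g(x)| ≥ C dist(x, 0)^δ` near the origin, for some
constants `C, δ > 0`. -/
def IsLojasiewicz {m : ℕ} (g : EuclideanSpace ℝ (Fin m) → ℝ) : Prop :=
  ∃ C δ : ℝ, 0 < C ∧ 0 < δ ∧ ∀ᶠ x in 𝓝 (0 : EuclideanSpace ℝ (Fin m)), C * dist x 0 ^ δ ≤ |g x|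

end SmoothEq

/-!
# Smooth solutions of `F(x, y) = 0` with a prescribed formal solution

Call a germ flat if it is `O(‖x‖ ^ N)` for every `N`. The ideal `𝔪^∞` consists exactly of the flat
smooth germs (`mk_mem_maxIdealInfty`), and everything rests on one division property: the quotient
of a flat smooth germ by a smooth germ `d` with `|d(x)| ≥ C ‖x‖ ^ δ` is again smooth and flat
(`SmoothNear.inv_smul_of_flat`). Its derivative `d⁻² (d Df - f Dd)` is a quotient of the same kind,
because the derivative of a flat smooth germ is flat (`Flat.fderiv`), and so one can induct on the
order of differentiability.

The division property says that the Łojasiewicz condition implies `d 𝔪^∞ = 𝔪^∞`. Conversely, if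
`|d(a i)| < ‖a i‖ ^ (2 (i + 1))` along a sequence tending to `0`, a sum of bumps of height
`‖a i‖ ^ i` around the points `a i` is a flat smooth function that `d` does not divide
(`exists_flat_ge`, `isLojasiewicz_of_span_mul_maxIdealInfty`).

For the solution of the equation, the formal identity means that `x ↦ F(x, y₀(x))` is flat: Taylor
polynomials approximate smooth functions to any order, and such approximations can be substituted
into each other (`flat_comp_of_subst_eq_zero`). Write `A` for the Jacobian matrix in `y` along `y₀`
and `B = Aᵀ adj(A Aᵀ)`, so that `A B = d`. By Hadamard's lemma, `F(x, y₀ + u)` is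
`F(x, y₀) + A u + R(x, y₀, u)(u, u)` with `R` smooth. With `u = d B w` and `F(x, y₀) = d² f`, where
`f` is flat by the division property, the equation becomes `d² (f + w + Q(x, w)) = 0` with `Q`
quadratic in `w`. The inverse function theorem gives a smooth `w` with `w + Q(x, w) = -f`, and `w`
is flat because `w = O(f)`. Hence `y₀ + d B w` is a solution with the same Taylor series as `y₀`
(`exists_flat_correction`).
-/

open Filter
open scoped Topology ContDiff

namespace SmoothEq

/-! ### Smooth germs of maps -/

section Smooth

variable {U V W Z : Type*} [NormedAddCommGroup U] [NormedSpace ℝ U]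
  [NormedAddCommGroup V] [NormedSpace ℝ V] [NormedAddCommGroup W] [NormedSpace ℝ W]
  [NormedAddCommGroup Z] [NormedSpace ℝ Z]

theorem SmoothNear.contDiffAt {f : V → W} {a : V} (hf : SmoothNear f a) : ContDiffAt ℝ ∞ f a :=
  hf.self_of_nhds

theorem SmoothNear.continuousAt {f : V → W} {a : V} (hf : SmoothNear f a) : ContinuousAt f a :=
  hf.contDiffAt.continuousAt

theorem SmoothNear.differentiableAt {f : V → W} {a : V} (hf : SmoothNear f a) :
    ∀ᶠ x in 𝓝 a, DifferentiableAt ℝ f x :=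
  Eventually.mono hf fun _ h => h.differentiableAt (by simp)

theorem _root_.ContDiff.smoothNear {f : V → W} (hf : ContDiff ℝ ∞ f) (a : V) : SmoothNear f a :=
  Eventually.of_forall fun _ => hf.contDiffAt

theorem SmoothNear.comp {f : V → W} {g : U → V} {a : U} (hf : SmoothNear f (g a))
    (hg : SmoothNear g a) : SmoothNear (fun x => f (g x)) a := by
  filter_upwards [hg, hg.continuousAt.eventually hf] with x h1 h2 using h2.comp x h1

theorem SmoothNear.prodMk {f : U → V} {g : U → W} {a : U} (hf : SmoothNear f a)
    (hg : SmoothNear g a) : SmoothNear (fun x => (f x, g x)) a := by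
  filter_upwards [hf, hg] with x h1 h2 using h1.prodMk h2

theorem SmoothNear.add {f g : V → W} {a : V} (hf : SmoothNear f a) (hg : SmoothNear g a) :
    SmoothNear (fun x => f x + g x) a := by
  filter_upwards [hf, hg] with x h1 h2 using h1.add h2

theorem SmoothNear.smul {c : V → ℝ} {f : V → W} {a : V} (hc : SmoothNear c a)
    (hf : SmoothNear f a) : SmoothNear (fun x => c x • f x) a := by
  filter_upwards [hc, hf] with x h1 h2 using h1.smul h2

theorem SmoothNear.clm_apply {f : U → V →L[ℝ] W} {g : U → V} {a : U} (hf : SmoothNear f a)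
    (hg : SmoothNear g a) : SmoothNear (fun x => f x (g x)) a := by
  filter_upwards [hf, hg] with x h1 h2 using h1.clm_apply h2

theorem SmoothNear.fderiv {f : V → W} {a : V} (hf : SmoothNear f a) :
    SmoothNear (fderiv ℝ f) a := by
  filter_upwards [hf] with x h using h.fderiv_right (by simp)

end Smooth

/-! ### Flat functions -/

section Flat

variable {V W : Type*} [NormedAddCommGroup V] [NormedAddCommGroup W]

/-- `f` is flat at the origin: it decays there faster than every power of the norm. For a smooth
germ this means that all derivatives vanish at the origin (`flat_of_iteratedFDeriv_eq_zero` and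
`Flat.iteratedFDeriv_eq_zero`). -/
def Flat (f : V → W) : Prop :=
  ∀ N : ℕ, f =O[𝓝 0] fun x => ‖x‖ ^ N

theorem Flat.apply_zero {f : V → W} (hf : Flat f) : f 0 = 0 := by
  obtain ⟨C, hC⟩ := (hf 1).bound
  simpa using hC.self_of_nhds

theorem isBigO_norm_pow_of_le {M N : ℕ} (h : M ≤ N) :
    (fun x : V => ‖x‖ ^ N) =O[𝓝 0] fun x => ‖x‖ ^ M := by
  refine Asymptotics.IsBigO.of_bound 1 ?_
  filter_upwards [Metric.ball_mem_nhds (0 : V) one_pos] with x hx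
  rw [mem_ball_zero_iff] at hx
  simpa using pow_le_pow_of_le_one (norm_nonneg x) hx.le h

/-- It suffices to check flatness for large exponents. -/
theorem Flat.of_succ {f : V → W} (h : ∀ N : ℕ, f =O[𝓝 0] fun x => ‖x‖ ^ (N + 1)) : Flat f :=
  fun N => (h N).trans (isBigO_norm_pow_of_le N.le_succ)

/-- `d` is bounded below by a multiple of some power of the norm; `IsLojasiewicz` with an integer
exponent. -/
def DominatesPow (d : V → ℝ) : Prop :=
  ∃ K : ℕ, (fun x => ‖x‖ ^ K) =O[𝓝 0] d

theorem DominatesPow.eventually_ne_zero {d : V → ℝ} (hd : DominatesPow d) :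
    ∀ᶠ x in 𝓝 0, x ≠ 0 → d x ≠ 0 := by
  obtain ⟨K, hK⟩ := hd
  obtain ⟨C, hC⟩ := hK.bound
  filter_upwards [hC] with x hx hx0 h
  rw [h, norm_zero, mul_zero, norm_pow, norm_norm] at hx
  exact absurd hx (not_le.2 (pow_pos (norm_pos_iff.2 hx0) _))

theorem DominatesPow.mul {d e : V → ℝ} (hd : DominatesPow d) (he : DominatesPow e) :
    DominatesPow fun x => d x * e x := by
  obtain ⟨K, hK⟩ := hd
  obtain ⟨L, hL⟩ := he
  exact ⟨K + L, by simpa only [pow_add] using hK.mul hL⟩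

theorem Flat.smul [NormedSpace ℝ W] {f : V → W} (hf : Flat f) {c : V → ℝ}
    (hc : ContinuousAt c 0) : Flat fun x => c x • f x := fun N => by
  simpa using (hc.isBigO_one ℝ).smul (hf N)

theorem Flat.inv_smul [NormedSpace ℝ W] {f : V → W} (hf : Flat f) {d : V → ℝ}
    (hd : DominatesPow d) : Flat fun x => (d x)⁻¹ • f x := by
  obtain ⟨K, hK⟩ := hd
  obtain ⟨C, hC0, hC⟩ := hK.exists_nonneg
  intro N
  obtain ⟨D, hD0, hD⟩ := (hf (N + K)).exists_nonneg
  refine Asymptotics.IsBigO.of_bound (D * C) ?_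
  filter_upwards [hC.bound, hD.bound] with x h1 h2
  rcases eq_or_ne (d x) 0 with h | h
  · rw [h, inv_zero, zero_smul, norm_zero]
    positivity
  · rw [norm_smul, norm_inv, inv_mul_le_iff₀ (norm_pos_iff.2 h)]
    refine h2.trans ?_
    rw [norm_pow, norm_norm] at h1 ⊢
    rw [norm_pow, norm_norm]
    calc D * ‖x‖ ^ (N + K) = D * ‖x‖ ^ N * ‖x‖ ^ K := by ring
      _ ≤ D * ‖x‖ ^ N * (C * ‖d x‖) := by gcongr
      _ = ‖d x‖ * (D * C * ‖x‖ ^ N) := by ring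

end Flat

section FlatDerivative

-- One universe for `V` and `W`, so that inductions may pass from `W` to `V →L[ℝ] W`.
universe u

variable {V W : Type u} [NormedAddCommGroup V] [NormedSpace ℝ V]
  [NormedAddCommGroup W] [NormedSpace ℝ W]

/-- The mean value inequality for orders of vanishing. -/
theorem isBigO_norm_pow_succ_of_fderiv {f : V → W} {N : ℕ}
    (hf : ∀ᶠ x in 𝓝 (0 : V), DifferentiableAt ℝ f x) (h0 : f 0 = 0)
    (hd : fderiv ℝ f =O[𝓝 0] fun x => ‖x‖ ^ N) : f =O[𝓝 0] fun x => ‖x‖ ^ (N + 1) := by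
  obtain ⟨C, hC0, hC⟩ := hd.exists_nonneg
  obtain ⟨r, hr, hball⟩ := Metric.eventually_nhds_iff_ball.1 (hf.and hC.bound)
  refine Asymptotics.IsBigO.of_bound C ?_
  filter_upwards [Metric.ball_mem_nhds (0 : V) hr] with x hx
  have hsub : ∀ y ∈ Metric.closedBall (0 : V) ‖x‖, y ∈ Metric.ball (0 : V) r := fun y hy => by
    rw [mem_closedBall_zero_iff] at hy
    rw [mem_ball_zero_iff] at hx ⊢
    exact hy.trans_lt hx
  have := Convex.norm_image_sub_le_of_norm_hasFDerivWithin_le (𝕜 := ℝ) (f := f)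
    (f' := _root_.fderiv ℝ f) (C := C * ‖x‖ ^ N) (s := Metric.closedBall (0 : V) ‖x‖)
    (x := 0) (y := x)
    (fun y hy => (hball y (hsub y hy)).1.hasFDerivAt.hasFDerivWithinAt)
    (fun y hy => by
      refine (hball y (hsub y hy)).2.trans ?_
      rw [mem_closedBall_zero_iff] at hy
      rw [norm_pow, norm_norm]
      gcongr)
    (convex_closedBall _ _) (by simp) (by simp)
  rw [h0, sub_zero, sub_zero] at this
  rw [norm_pow, norm_norm, pow_succ, ← mul_assoc]
  exact this

theorem hasFDerivAt_zero_of_isBigO {f : V → W} (h : f =O[𝓝 0] fun x => ‖x‖ ^ 2) :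
    HasFDerivAt f (0 : V →L[ℝ] W) 0 := by
  have h0 : f 0 = 0 := by
    obtain ⟨C, hC⟩ := h.bound
    simpa using hC.self_of_nhds
  rw [hasFDerivAt_iff_isLittleO_nhds_zero]
  simp only [zero_add, h0, sub_zero, zero_apply]
  refine h.trans_isLittleO ?_
  exact Asymptotics.isLittleO_norm_pow_id one_lt_two

/-- The derivative of a smooth flat germ is flat: since the second derivative is bounded, a
difference quotient with step `‖x‖ ^ N` approximates the derivative at `x` up to `O(‖x‖ ^ N)`,
while the flatness of `f` makes that quotient `O(‖x‖ ^ N)` as well. -/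
theorem Flat.fderiv {f : V → W} (hf : Flat f) (hs : SmoothNear f 0) : Flat (fderiv ℝ f) := by
  refine Flat.of_succ fun M => ?_
  set N := M + 1 with hN
  obtain ⟨K, t, ht, hK⟩ :=
    (hs.contDiffAt.fderiv_right (m := 1) (by norm_cast)).exists_lipschitzOnWith
  obtain ⟨C, hC0, hC⟩ := (hf (2 * N)).exists_nonneg
  obtain ⟨r, hr, hball⟩ := Metric.eventually_nhds_iff_ball.1
    ((hs.differentiableAt.and hC.bound).and ht)
  refine Asymptotics.IsBigO.of_bound (C * 2 ^ (2 * N) + C + K) ?_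
  filter_upwards [Metric.ball_mem_nhds (0 : V) (half_pos hr),
    Metric.ball_mem_nhds (0 : V) one_pos] with x hx hx1
  rw [mem_ball_zero_iff] at hx hx1
  rw [norm_pow, norm_norm]
  rcases eq_or_ne x 0 with rfl | hx0
  · rw [(hasFDerivAt_zero_of_isBigO (hf 2)).fderiv]
    rw [norm_zero, norm_zero, zero_pow (by omega), mul_zero]
  have hpos : 0 < ‖x‖ := norm_pos_iff.2 hx0
  refine ContinuousLinearMap.opNorm_le_of_unit_norm (by positivity) fun v hv => ?_
  set h : V := ‖x‖ ^ N • v with hh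
  have hhn : ‖h‖ = ‖x‖ ^ N := by rw [hh, norm_smul, hv, mul_one, norm_pow, norm_norm]
  have hhx : ‖h‖ ≤ ‖x‖ := by
    rw [hhn]
    calc ‖x‖ ^ N ≤ ‖x‖ ^ 1 := pow_le_pow_of_le_one hpos.le hx1.le (by omega)
      _ = ‖x‖ := pow_one _
  have hsum : ‖x + h‖ ≤ 2 * ‖x‖ := (norm_add_le _ _).trans (by linarith)
  have hxr : x ∈ Metric.ball (0 : V) r := by rw [mem_ball_zero_iff]; linarith
  have hxhr : x + h ∈ Metric.ball (0 : V) r := by rw [mem_ball_zero_iff]; linarith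
  have hseg : segment ℝ x (x + h) ⊆ Metric.ball (0 : V) r :=
    (convex_ball (0 : V) r).segment_subset hxr hxhr
  have key := Convex.norm_image_sub_le_of_norm_hasFDerivWithin_le' (𝕜 := ℝ) (f := f)
    (f' := _root_.fderiv ℝ f) (φ := _root_.fderiv ℝ f x) (C := K * ‖h‖)
    (s := segment ℝ x (x + h)) (x := x) (y := x + h)
    (fun y hy => (hball y (hseg hy)).1.1.hasFDerivAt.hasFDerivWithinAt)
    (fun y hy => by
      refine (hK.norm_sub_le (hball y (hseg hy)).2 (hball x hxr).2).trans ?_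
      gcongr
      obtain ⟨a, b, ha, hb, hab, rfl⟩ := hy
      have : a • x + b • (x + h) - x = b • h := by
        rw [smul_add, ← add_assoc, ← add_smul, hab, one_smul, add_sub_cancel_left]
      rw [this, norm_smul, Real.norm_of_nonneg hb]
      exact mul_le_of_le_one_left (norm_nonneg _) (by linarith))
    (convex_segment _ _) (left_mem_segment _ _ _) (right_mem_segment _ _ _)
  rw [add_sub_cancel_left] at key
  have e1 : ‖f (x + h)‖ ≤ C * 2 ^ (2 * N) * (‖x‖ ^ N * ‖x‖ ^ N) := by
    refine (hball _ hxhr).1.2.trans ?_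
    rw [norm_pow, norm_norm, ← pow_add, ← two_mul, mul_assoc, ← mul_pow]
    gcongr
  have e2 : ‖f x‖ ≤ C * (‖x‖ ^ N * ‖x‖ ^ N) := by
    refine (hball _ hxr).1.2.trans ?_
    rw [norm_pow, norm_norm, ← pow_add, ← two_mul]
  have e3 : ‖_root_.fderiv ℝ f x h‖ ≤ (C * 2 ^ (2 * N) + C + K) * ‖x‖ ^ N * ‖x‖ ^ N := by
    have h1 : _root_.fderiv ℝ f x h =
        f (x + h) - f x - (f (x + h) - f x - _root_.fderiv ℝ f x h) := by abel
    rw [h1]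
    refine (norm_sub_le _ _).trans ?_
    have := norm_sub_le (f (x + h)) (f x)
    rw [hhn] at key
    nlinarith [key, this, e1, e2]
  rw [hh, map_smul, norm_smul, norm_pow, norm_norm, mul_comm] at e3
  exact le_of_mul_le_mul_right e3 (by positivity)

theorem Flat.iteratedFDeriv_eq_zero {f : V → W} (hf : Flat f) (hs : SmoothNear f 0) (k : ℕ) :
    iteratedFDeriv ℝ k f 0 = 0 := by
  induction k generalizing W with
  | zero =>
    ext v
    simp [hf.apply_zero]
  | succ k ih =>
    rw [← norm_eq_zero, ← norm_iteratedFDeriv_fderiv, ih (hf.fderiv hs) hs.fderiv, norm_zero]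

theorem flat_of_iteratedFDeriv_eq_zero {f : V → W} (hs : SmoothNear f 0)
    (h : ∀ k, iteratedFDeriv ℝ k f 0 = 0) : Flat f := by
  intro N
  induction N generalizing W with
  | zero => simpa using hs.continuousAt.isBigO_one ℝ
  | succ N ih =>
    refine isBigO_norm_pow_succ_of_fderiv hs.differentiableAt ?_ (ih hs.fderiv fun k => ?_)
    · simpa using congrArg (fun m => m 0) (h 0)
    · rw [← norm_eq_zero, norm_iteratedFDeriv_fderiv, h, norm_zero]

/-- The quotient rule for a flat numerator; at the origin, where `d` may vanish, both sides are
zero. -/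
theorem Flat.hasFDerivAt_inv_smul {d : V → ℝ} (hd : DominatesPow d) (hds : SmoothNear d 0)
    {f : V → W} (hf : Flat f) (hs : SmoothNear f 0) :
    ∀ᶠ x in 𝓝 0, HasFDerivAt (fun x => (d x)⁻¹ • f x) ((d x * d x)⁻¹ •
      (d x • _root_.fderiv ℝ f x - (_root_.fderiv ℝ d x).smulRight (f x))) x := by
  filter_upwards [hd.eventually_ne_zero, hs.differentiableAt, hds.differentiableAt] with x h1 h2 h3
  rcases eq_or_ne x 0 with rfl | hx
  · have := hasFDerivAt_zero_of_isBigO (hf.inv_smul hd 2)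
    rwa [hf.apply_zero, (hf.fderiv hs).apply_zero, smul_zero, ContinuousLinearMap.smulRight_zero,
      sub_zero, smul_zero]
  · have := ((hasDerivAt_inv (h1 hx)).comp_hasFDerivAt x h3.hasFDerivAt).smul h2.hasFDerivAt
    refine this.congr_fderiv ?_
    ext v
    have := h1 hx
    simp only [smul_apply, sub_apply, ContinuousLinearMap.smulRight_apply, add_apply,
      Function.comp_apply, smul_sub, smul_smul, smul_eq_mul]
    rw [sub_eq_add_neg, ← neg_smul]
    congr 2 <;> field_simp

/-- The quotient of a smooth flat germ by a smooth germ that satisfies the Łojasiewicz condition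
is of class `C^n`: its derivative `d⁻² (d Df - f Dd)` is again such a quotient. -/
theorem Flat.contDiffAt_inv_smul {d : V → ℝ} (hd : DominatesPow d) (hds : SmoothNear d 0)
    {f : V → W} (hf : Flat f) (hs : SmoothNear f 0) (n : ℕ) :
    ContDiffAt ℝ n (fun x => (d x)⁻¹ • f x) 0 := by
  induction n generalizing W d with
  | zero =>
    rw [Nat.cast_zero, contDiffAt_zero]
    exact ⟨_, hf.hasFDerivAt_inv_smul hd hds hs,
      fun x hx => (HasFDerivAt.continuousAt hx).continuousWithinAt⟩
  | succ n ih =>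
    rw [Nat.cast_succ, contDiffAt_succ_iff_hasFDerivAt]
    refine ⟨_, ⟨_, hf.hasFDerivAt_inv_smul hd hds hs, fun x hx => hx⟩,
      ih (hd.mul hd) (hds.smul hds) ?_ ?_⟩
    · intro N
      refine ((hf.fderiv hs).smul hds.continuousAt N).sub (Asymptotics.IsBigO.of_norm_left ?_)
      simpa [ContinuousLinearMap.norm_smulRight_apply] using
        (hds.fderiv.continuousAt.norm.isBigO_one ℝ).mul (hf N).norm_left
    · filter_upwards [hds, hds.fderiv, hs, hs.fderiv] with x h1 h2 h3 h4
      exact (h1.smul h4).sub (h2.smulRight h3)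

theorem SmoothNear.inv_smul_of_flat {d : V → ℝ} (hd : DominatesPow d) (hds : SmoothNear d 0)
    {f : V → W} (hf : Flat f) (hs : SmoothNear f 0) : SmoothNear (fun x => (d x)⁻¹ • f x) 0 := by
  filter_upwards [hd.eventually_ne_zero, hs, hds] with x h1 h2 h3
  rcases eq_or_ne x 0 with rfl | hx
  · exact contDiffAt_infty.2 fun n => hf.contDiffAt_inv_smul hd hds hs n
  · exact (h3.inv (h1 hx)).smul h2

end FlatDerivative

/-! ### The ideal `𝔪^∞` and the Łojasiewicz condition -/

section Ideal

variable {m : ℕ}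

theorem isBigO_norm_pow_of_mem_maxIdeal_pow {k : ℕ} {g : SmoothGerm m} (hg : g ∈ maxIdeal m ^ k) :
    ∃ f : EuclideanSpace ℝ (Fin m) → ℝ, (f : Germ (𝓝 (0 : EuclideanSpace ℝ (Fin m))) ℝ) = g ∧
      f =O[𝓝 0] fun x => ‖x‖ ^ k := by
  induction k generalizing g with
  | zero =>
    obtain ⟨f, hf, hfg⟩ := g.2
    exact ⟨f, hfg, by simpa using hf.continuousAt.isBigO_one ℝ⟩
  | succ k ih =>
    rw [pow_succ] at hg
    refine Submodule.mul_induction_on hg ?_ ?_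
    · intro a ha b hb
      obtain ⟨f, hfa, hf⟩ := ih ha
      obtain ⟨h, hh, hhb⟩ := b.2
      have h0 : h 0 = 0 := by
        have : (b : Germ (𝓝 (0 : EuclideanSpace ℝ (Fin m))) ℝ).value = 0 := hb
        rw [← hhb] at this
        exact this
      refine ⟨f * h, by rw [Germ.coe_mul, hfa, hhb]; rfl, ?_⟩
      have := (hh.contDiffAt.differentiableAt (by simp)).isBigO_sub
      simp only [h0, sub_zero] at this
      simp only [pow_succ]
      exact hf.mul this.norm_right
    · rintro a b ⟨f, hf, hfO⟩ ⟨h, hh, hhO⟩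
      exact ⟨f + h, by rw [Germ.coe_add, hf, hh]; rfl, hfO.add hhO⟩

/-- The ideal `𝔪^∞` consists of the flat germs: a flat germ is divisible by every power of the
square of the norm. -/
theorem mk_mem_maxIdealInfty {f : EuclideanSpace ℝ (Fin m) → ℝ} (hf : SmoothNear f 0) :
    SmoothGerm.mk f hf ∈ maxIdealInfty m ↔ Flat f := by
  rw [maxIdealInfty, Submodule.mem_iInf]
  refine ⟨fun h k => ?_, fun h k => ?_⟩
  · obtain ⟨g, hg, hO⟩ := isBigO_norm_pow_of_mem_maxIdeal_pow (h k)
    exact (Germ.coe_eq.1 hg.symm : f =ᶠ[𝓝 0] g).trans_isBigO hO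
  · have hq : SmoothNear (fun x : EuclideanSpace ℝ (Fin m) => ‖x‖ ^ 2) 0 :=
      (contDiff_norm_sq ℝ).smoothNear 0
    have hqk : SmoothNear (fun x : EuclideanSpace ℝ (Fin m) => (‖x‖ ^ 2) ^ k) 0 :=
      ((contDiff_norm_sq ℝ).pow k).smoothNear 0
    have hd : DominatesPow (fun x : EuclideanSpace ℝ (Fin m) => (‖x‖ ^ 2) ^ k) :=
      ⟨2 * k, by simpa only [pow_mul] using Asymptotics.isBigO_refl _ _⟩
    have hs := SmoothNear.inv_smul_of_flat hd hqk h hf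
    have heq : SmoothGerm.mk f hf = SmoothGerm.mk _ hq ^ k * SmoothGerm.mk _ hs := by
      refine Subtype.ext (Germ.coe_eq.2 ?_)
      filter_upwards [hd.eventually_ne_zero] with x hx
      rcases eq_or_ne x 0 with rfl | hx0
      · simp [h.apply_zero]
      · simp [mul_inv_cancel_left₀ (hx hx0)]
    rw [heq]
    refine Ideal.mul_mem_right _ _ (Ideal.pow_mem_pow ?_ k)
    change ‖(0 : EuclideanSpace ℝ (Fin m))‖ ^ 2 = 0
    simp

theorem exists_mk_of_mem_maxIdealInfty {g : SmoothGerm m} (hg : g ∈ maxIdealInfty m) :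
    ∃ (f : EuclideanSpace ℝ (Fin m) → ℝ) (hf : SmoothNear f 0),
      SmoothGerm.mk f hf = g ∧ Flat f := by
  obtain ⟨g, f, hf, rfl⟩ := g
  exact ⟨f, hf, rfl, (mk_mem_maxIdealInfty hf).1 hg⟩

theorem IsLojasiewicz.dominatesPow {d : EuclideanSpace ℝ (Fin m) → ℝ} (hd : IsLojasiewicz d) :
    DominatesPow d := by
  obtain ⟨C, δ, hC, hδ, h⟩ := hd
  refine ⟨⌈δ⌉₊, Asymptotics.IsBigO.of_bound C⁻¹ ?_⟩
  filter_upwards [h, Metric.ball_mem_nhds 0 one_pos] with x hx hx1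
  rw [mem_ball_zero_iff] at hx1
  rw [norm_pow, norm_norm, le_inv_mul_iff₀ hC]
  rw [dist_zero_right] at hx
  refine le_trans ?_ hx
  gcongr
  rw [← Real.rpow_natCast]
  exact Real.rpow_le_rpow_of_exponent_ge' (norm_nonneg x) hx1.le hδ.le (Nat.le_ceil δ)

theorem span_mul_maxIdealInfty_of_dominatesPow {d : EuclideanSpace ℝ (Fin m) → ℝ}
    (hs : SmoothNear d 0) (hd : DominatesPow d) :
    Ideal.span {SmoothGerm.mk d hs} * maxIdealInfty m = maxIdealInfty m := by
  refine le_antisymm Ideal.mul_le_right fun g hg => ?_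
  obtain ⟨f, hf, rfl, hflat⟩ := exists_mk_of_mem_maxIdealInfty hg
  rw [Ideal.mem_span_singleton_mul]
  refine ⟨SmoothGerm.mk _ (SmoothNear.inv_smul_of_flat hd hs hflat hf),
    (mk_mem_maxIdealInfty _).2 (hflat.inv_smul hd), Subtype.ext (Germ.coe_eq.2 ?_)⟩
  filter_upwards [hd.eventually_ne_zero] with x hx
  rcases eq_or_ne x 0 with rfl | hx0
  · simp [hflat.apply_zero]
  · simp [mul_inv_cancel_left₀ (hx hx0)]

/-- There are smooth flat functions that decay slowly along a given sequence tending rapidly to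
the origin: a sum of bumps of height `‖a i‖ ^ i` and width comparable to `‖a i‖`, centred at the
points `a i`. -/
theorem exists_flat_ge {a : ℕ → EuclideanSpace ℝ (Fin m)} (h0 : ∀ i, a i ≠ 0)
    (ha : ∀ i, ‖a i‖ ≤ (1 / 2) ^ i) :
    ∃ f : EuclideanSpace ℝ (Fin m) → ℝ, SmoothNear f 0 ∧ Flat f ∧ ∀ i, ‖a i‖ ^ i ≤ f (a i) := by
  let ψ : ContDiffBump (0 : EuclideanSpace ℝ (Fin m)) := ⟨1 / 2, 1, by norm_num, by norm_num⟩
  have hψ : ContDiff ℝ ∞ ψ := ψ.contDiff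
  have hbd : ∀ k, ∃ C, ∀ x, ‖iteratedFDeriv ℝ k ψ x‖ ≤ C := fun k =>
    (ψ.hasCompactSupport.iteratedFDeriv k).exists_bound_of_continuous
      (hψ.continuous_iteratedFDeriv (by exact_mod_cast le_top))
  choose M hM using hbd
  have hr : ∀ i, 0 < ‖a i‖ := fun i => norm_pos_iff.2 (h0 i)
  let φ : ℕ → EuclideanSpace ℝ (Fin m) → ℝ := fun i x =>
    ‖a i‖ ^ i • ψ ((2 / ‖a i‖) • (x - a i))
  have hψ' : ∀ i, ContDiff ℝ ∞ fun x => ψ ((2 / ‖a i‖) • (x - a i)) := fun i =>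
    hψ.comp ((contDiff_id.sub contDiff_const).const_smul _)
  have hφ : ∀ i, ContDiff ℝ ∞ (φ i) := fun i => (hψ' i).const_smul _
  let v : ℕ → ℕ → ℝ := fun k i => ‖a i‖ ^ i * ((2 / ‖a i‖) ^ k * M k)
  have hv : ∀ k i x, ‖iteratedFDeriv ℝ k (φ i) x‖ ≤ v k i := by
    intro k i x
    have hk : ((k : ℕ∞) : WithTop ℕ∞) ≤ ∞ := by exact_mod_cast le_top
    have e1 : iteratedFDeriv ℝ k (φ i) x =
        ‖a i‖ ^ i • ((2 / ‖a i‖) ^ k • iteratedFDeriv ℝ k ψ ((2 / ‖a i‖) • (x - a i))) := by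
      rw [iteratedFDeriv_const_smul_apply' ((hψ' i).contDiffAt.of_le hk),
        iteratedFDeriv_comp_sub (f := fun y => ψ ((2 / ‖a i‖) • y)) k (a i) x,
        iteratedFDeriv_comp_const_smul _ (hψ.of_le hk)]
    rw [e1, norm_smul, norm_smul, norm_pow, norm_pow, norm_norm,
      Real.norm_of_nonneg (div_nonneg zero_le_two (hr i).le)]
    have := hM k ((2 / ‖a i‖) • (x - a i))
    have := hr i
    change _ ≤ ‖a i‖ ^ i * ((2 / ‖a i‖) ^ k * M k)
    gcongr
  have hsum : ∀ k, Summable (v k) := by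
    intro k
    refine Summable.of_norm_bounded_eventually_nat
      (g := fun i => (2 ^ k * |M k|) * (1 / 2 : ℝ) ^ i)
      ((summable_geometric_of_lt_one (by norm_num) (by norm_num)).mul_left _) ?_
    filter_upwards [eventually_ge_atTop (k + 1)] with i hi
    obtain ⟨j, rfl⟩ := Nat.exists_eq_add_of_le hi
    have hpos := hr (k + 1 + j)
    have hle := ha (k + 1 + j)
    set r := ‖a (k + 1 + j)‖ with hrdef
    have hr1 : r ≤ 1 := hle.trans (pow_le_one₀ (by norm_num) (by norm_num))
    have e : v k (k + 1 + j) = 2 ^ k * M k * (r * r ^ j) := by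
      simp only [v, ← hrdef]
      rw [div_pow, pow_add, pow_add, pow_one]
      field_simp
    rw [e, norm_mul, norm_mul, Real.norm_of_nonneg (by positivity : (0 : ℝ) ≤ 2 ^ k),
      Real.norm_of_nonneg (by positivity : 0 ≤ r * r ^ j), Real.norm_eq_abs]
    refine mul_le_mul_of_nonneg_left ?_ (by positivity)
    calc r * r ^ j ≤ r * 1 := by gcongr; exact pow_le_one₀ hpos.le hr1
      _ = r := mul_one r
      _ ≤ _ := hle
  have hsm : ContDiff ℝ ∞ fun x => ∑' i, φ i x :=
    contDiff_tsum hφ (fun k _ => hsum k) fun k i x _ => hv k i x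
  refine ⟨fun x => ∑' i, φ i x, hsm.smoothNear 0, ?_, fun i => ?_⟩
  · refine flat_of_iteratedFDeriv_eq_zero (hsm.smoothNear 0) fun k => ?_
    rw [iteratedFDeriv_tsum_apply (N := ⊤) hφ (fun k _ => hsum k) (fun k i x _ => hv k i x)
      (by exact_mod_cast le_top)]
    refine (tsum_congr fun i => ?_).trans tsum_zero
    have hz : φ i =ᶠ[𝓝 0] fun _ => 0 := by
      filter_upwards [Metric.ball_mem_nhds (0 : EuclideanSpace ℝ (Fin m)) (half_pos (hr i))]
        with x hx
      rw [mem_ball_zero_iff] at hx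
      have hfar : ‖a i‖ / 2 ≤ ‖x - a i‖ := by
        have := norm_sub_norm_le (a i) x
        rw [norm_sub_rev] at this
        linarith
      have : ψ ((2 / ‖a i‖) • (x - a i)) = 0 := by
        refine ψ.zero_of_le_dist ?_
        rw [dist_zero_right, norm_smul, Real.norm_of_nonneg (div_nonneg zero_le_two (hr i).le)]
        change 1 ≤ _
        have := hr i
        rw [div_mul_eq_mul_div, one_le_div this]
        linarith
      simp only [φ, this, smul_zero]
    rw [(hz.iteratedFDeriv ℝ k).eq_of_nhds]
    simp
  · have hs : Summable fun j => φ j (a i) := by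
      refine Summable.of_norm_bounded (hsum 0) fun j => ?_
      simpa using hv 0 j (a i)
    have hnn : ∀ j, 0 ≤ φ j (a i) := fun j =>
      mul_nonneg (pow_nonneg (norm_nonneg _) _) ψ.nonneg
    have hi : φ i (a i) = ‖a i‖ ^ i := by
      have : ψ 0 = 1 := ψ.one_of_mem_closedBall (by simp [ψ])
      simp [φ, this]
    rw [← hi]
    exact hs.le_tsum i fun j _ => hnn j

theorem isLojasiewicz_of_span_mul_maxIdealInfty {d : EuclideanSpace ℝ (Fin m) → ℝ}
    (hs : SmoothNear d 0)
    (h : Ideal.span {SmoothGerm.mk d hs} * maxIdealInfty m = maxIdealInfty m) :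
    IsLojasiewicz d := by
  by_contra hL
  have hfreq : ∀ i : ℕ, ∃ x : EuclideanSpace ℝ (Fin m),
      ‖x‖ ≤ (1 / 2) ^ i ∧ |d x| < ‖x‖ ^ (2 * (i + 1)) := by
    intro i
    have h1 : ∃ᶠ x in 𝓝 (0 : EuclideanSpace ℝ (Fin m)),
        ¬(1 * dist x 0 ^ ((2 * (i + 1) : ℕ) : ℝ) ≤ |d x|) := fun hev =>
      hL ⟨1, ((2 * (i + 1) : ℕ) : ℝ), one_pos, by positivity, by simpa only [not_not] using hev⟩
    obtain ⟨x, hx, hx'⟩ := (h1.and_eventually (Metric.closedBall_mem_nhds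
      (0 : EuclideanSpace ℝ (Fin m)) (by positivity : (0 : ℝ) < (1 / 2) ^ i))).exists
    rw [one_mul, Real.rpow_natCast, dist_zero_right, not_le] at hx
    exact ⟨x, mem_closedBall_zero_iff.1 hx', hx⟩
  choose a ha hda using hfreq
  have h0 : ∀ i, a i ≠ 0 := fun i hi => by
    have := hda i
    rw [hi, norm_zero, zero_pow (by omega)] at this
    exact absurd this (not_lt.2 (abs_nonneg _))
  obtain ⟨f, hf, hflat, hge⟩ := exists_flat_ge h0 ha
  have hmem := (mk_mem_maxIdealInfty hf).2 hflat
  rw [← h, Ideal.mem_span_singleton_mul] at hmem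
  obtain ⟨z, hz, hdz⟩ := hmem
  obtain ⟨g, hg, rfl, hgflat⟩ := exists_mk_of_mem_maxIdealInfty hz
  have hprod : (fun x => d x * g x) =ᶠ[𝓝 0] f := Germ.coe_eq.1 (congrArg Subtype.val hdz)
  have hg1 : ∀ᶠ x in 𝓝 0, |g x| < 1 := by
    have := hg.continuousAt.abs
    refine this.eventually_lt continuousAt_const ?_
    simp [hgflat.apply_zero]
  have hlim : Tendsto a atTop (𝓝 0) :=
    squeeze_zero_norm ha (tendsto_pow_atTop_nhds_zero_of_lt_one (by norm_num) (by norm_num))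
  obtain ⟨i, h1, h2⟩ := (hlim.eventually (hprod.and hg1)).exists
  have hr : 0 < ‖a i‖ := norm_pos_iff.2 (h0 i)
  have hr1 : ‖a i‖ ≤ 1 := (ha i).trans (pow_le_one₀ (by norm_num) (by norm_num))
  have : ‖a i‖ ^ i < ‖a i‖ ^ (2 * (i + 1)) :=
    calc ‖a i‖ ^ i ≤ f (a i) := hge i
      _ = d (a i) * g (a i) := h1.symm
      _ ≤ |d (a i)| * |g (a i)| := (le_abs_self _).trans (abs_mul _ _).le
      _ ≤ |d (a i)| := mul_le_of_le_one_right (abs_nonneg _) h2.le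
      _ < _ := hda i
  exact absurd (pow_le_pow_of_le_one hr.le hr1 (by omega : i ≤ 2 * (i + 1))) (not_le.2 this)

end Ideal

/-! ### Hadamard's lemma -/

section Hadamard

universe u

variable {X U W : Type u} [NormedAddCommGroup X] [NormedSpace ℝ X] [ProperSpace X]
  [NormedAddCommGroup U] [NormedSpace ℝ U] [ProperSpace U]
  [NormedAddCommGroup W] [NormedSpace ℝ W]

theorem hasFDerivAt_integral_of_contDiff {g : X × ℝ → W} (hg : ContDiff ℝ 1 g) (x : X) :
    HasFDerivAt (fun x => ∫ t in (0 : ℝ)..1, g (x, t))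
      (∫ t in (0 : ℝ)..1, (fderiv ℝ g (x, t)).comp (ContinuousLinearMap.inl ℝ X ℝ)) x := by
  have hcont : Continuous fun z : X × ℝ => (fderiv ℝ g z).comp (ContinuousLinearMap.inl ℝ X ℝ) :=
    (hg.continuous_fderiv (by simp)).clm_comp continuous_const
  obtain ⟨C, hC⟩ := ((isCompact_closedBall x 1).prod
    (isCompact_Icc (a := (0 : ℝ)) (b := 1))).exists_bound_of_continuousOn hcont.continuousOn
  have hgt : ∀ y : X, Continuous fun t : ℝ => g (y, t) := fun y =>
    hg.continuous.comp (by fun_prop)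
  refine intervalIntegral.hasFDerivAt_integral_of_dominated_of_fderiv_le
    (F' := fun y t => (fderiv ℝ g (y, t)).comp (ContinuousLinearMap.inl ℝ X ℝ))
    (bound := fun _ => C) (Metric.closedBall_mem_nhds x one_pos)
    (Eventually.of_forall fun y => (hgt y).aestronglyMeasurable)
    ((hgt x).intervalIntegrable _ _)
    (hcont.comp (by fun_prop : Continuous fun t : ℝ => (x, t))).aestronglyMeasurable
    (Eventually.of_forall fun t ht y hy => hC (y, t) ⟨hy, ?_⟩)
    intervalIntegrable_const
    (Eventually.of_forall fun t _ y _ => ?_)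
  · rw [Set.uIoc_of_le zero_le_one] at ht
    exact Set.Ioc_subset_Icc_self ht
  · have h1 : HasFDerivAt (fun y : X => (y, t)) (ContinuousLinearMap.inl ℝ X ℝ) y :=
      hasFDerivAt_prodMk_left y t
    exact ((hg.differentiable (by simp)) (y, t)).hasFDerivAt.comp y h1

theorem contDiff_integral_nat (n : ℕ) {g : X × ℝ → W} (hg : ContDiff ℝ n g) :
    ContDiff ℝ n fun x => ∫ t in (0 : ℝ)..1, g (x, t) := by
  induction n generalizing W with
  | zero =>
    rw [Nat.cast_zero, contDiff_zero] at hg ⊢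
    exact intervalIntegral.continuous_parametric_intervalIntegral_of_continuous'
      (f := fun x t => g (x, t)) hg 0 1
  | succ n ih =>
    rw [Nat.cast_succ] at hg ⊢
    have hd := fun x => hasFDerivAt_integral_of_contDiff (hg.of_le (by simp)) x
    rw [contDiff_succ_iff_fderiv]
    refine ⟨fun x => (hd x).differentiableAt, by simp, ?_⟩
    rw [funext fun x => (hd x).fderiv]
    exact ih ((hg.fderiv_right le_rfl).clm_comp contDiff_const)

theorem contDiff_integral {g : X × ℝ → W} (hg : ContDiff ℝ ∞ g) :
    ContDiff ℝ ∞ fun x => ∫ t in (0 : ℝ)..1, g (x, t) :=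
  contDiff_infty.2 fun n => contDiff_integral_nat n (contDiff_infty.1 hg n)

/-- **Hadamard's lemma** with parameters. -/
theorem exists_hadamard [CompleteSpace W] {G : X × U → W} (hG : ContDiff ℝ ∞ G) :
    ∃ M : X × U → U →L[ℝ] W, ContDiff ℝ ∞ M ∧
      (∀ x, M (x, 0) = (fderiv ℝ G (x, 0)).comp (ContinuousLinearMap.inr ℝ X U)) ∧
      ∀ x u, G (x, u) = G (x, 0) + M (x, u) u := by
  let g : (X × U) × ℝ → U →L[ℝ] W := fun z =>
    (fderiv ℝ G (z.1.1, z.2 • z.1.2)).comp (ContinuousLinearMap.inr ℝ X U)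
  have hg : ContDiff ℝ ∞ g := by
    refine ContDiff.clm_comp ((hG.fderiv_right (m := ∞) (by simp)).comp ?_) contDiff_const
    exact contDiff_fst.fst.prodMk (contDiff_snd.smul contDiff_fst.snd)
  refine ⟨fun z => ∫ t in (0 : ℝ)..1, g (z, t), contDiff_integral hg, fun x => ?_, fun x u => ?_⟩
  · simp [g]
  · have hcont : Continuous fun t : ℝ => g ((x, u), t) := hg.continuous.comp (by fun_prop)
    have hd : ∀ t : ℝ, HasDerivAt (fun t : ℝ => G (x, t • u)) (g ((x, u), t) u) t := by
      intro t
      have h1 : HasDerivAt (fun t : ℝ => (x, t • u)) ((0 : X), u) t := by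
        simpa using (hasDerivAt_const t x).prodMk ((hasDerivAt_id t).smul_const u)
      exact ((hG.differentiable (by simp)) (x, t • u)).hasFDerivAt.comp_hasDerivAt t h1
    have := intervalIntegral.integral_eq_sub_of_hasDerivAt (a := 0) (b := 1) (fun t _ => hd t)
      ((hcont.clm_apply continuous_const).intervalIntegrable _ _)
    rw [ContinuousLinearMap.intervalIntegral_apply (hcont.intervalIntegrable _ _), this]
    simp

/-- Taylor's formula of order two in the variable `y`, with a smooth quadratic remainder. -/
theorem exists_quadratic_remainder [CompleteSpace W] {F : X × U → W} (hF : ContDiff ℝ ∞ F) :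
    ∃ R : (X × U) × U → U →L[ℝ] U →L[ℝ] W, ContDiff ℝ ∞ R ∧
      ∀ x y u, F (x, y + u) =
        F (x, y) + fderiv ℝ (fun y => F (x, y)) y u + R ((x, y), u) u u := by
  let G : (X × U) × U → W := fun z => F (z.1.1, z.1.2 + z.2)
  have hG : ContDiff ℝ ∞ G :=
    hF.comp (contDiff_fst.fst.prodMk (contDiff_fst.snd.add contDiff_snd))
  obtain ⟨M, hM, hM0, hGM⟩ := exists_hadamard hG
  obtain ⟨R, hR, -, hMR⟩ := exists_hadamard hM
  refine ⟨R, hR, fun x y u => ?_⟩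
  have h1 : M ((x, y), 0) = fderiv ℝ (fun y => F (x, y)) y := by
    have h2 : HasFDerivAt (fun u : U => G ((x, y), u)) (M ((x, y), 0)) 0 := by
      rw [hM0]
      exact ((hG.differentiable (by simp)) ((x, y), 0)).hasFDerivAt.comp 0
        (hasFDerivAt_prodMk_right (x, y) 0)
    have h3 := fderiv_comp_add_left (𝕜 := ℝ) (f := fun y => F (x, y)) y (x := 0)
    rw [add_zero] at h3
    rw [← h3]
    exact h2.fderiv.symm
  have h4 := hGM (x, y) u
  rw [hMR (x, y) u, h1] at h4
  simpa [G, add_assoc] using h4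

end Hadamard

/-- A smooth germ of a map has a representative that is smooth everywhere. -/
theorem SmoothNear.exists_contDiff {V W : Type*} [NormedAddCommGroup V] [NormedSpace ℝ V]
    [FiniteDimensional ℝ V] [NormedAddCommGroup W] [NormedSpace ℝ W] {f : V → W} {a : V}
    (hf : SmoothNear f a) : ∃ g : V → W, ContDiff ℝ ∞ g ∧ g =ᶠ[𝓝 a] f := by
  obtain ⟨r, hr, hball⟩ := Metric.eventually_nhds_iff_ball.1 hf
  let ψ : ContDiffBump a := ⟨r / 4, r / 2, by positivity, by linarith⟩
  refine ⟨fun x => ψ x • f x, contDiff_iff_contDiffAt.2 fun x => ?_, ?_⟩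
  · by_cases hx : dist x a < r
    · exact ψ.contDiff.contDiffAt.smul (hball x hx)
    · have : (fun x => ψ x • f x) =ᶠ[𝓝 x] fun _ => 0 := by
        have hlt : r / 2 < dist x a := by linarith
        filter_upwards [(continuous_id.dist continuous_const).continuousAt.eventually_const_lt hlt]
          with y hy
        rw [ψ.zero_of_le_dist (x := y) hy.le, zero_smul]
      exact contDiffAt_const.congr_of_eventuallyEq this
  · filter_upwards [ψ.eventuallyEq_one] with x hx
    rw [hx, Pi.one_apply, one_smul]

/-! ### Taylor series -/

section TaylorSeries

variable {σ V : Type} [NormedAddCommGroup V] [NormedSpace ℝ V]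

/-- The iterated partial derivative of `f` in the directions `e i`, for `i` in a list. -/
noncomputable def iterPartial (e : σ → V) (l : List σ) (f : V → ℝ) : V → ℝ :=
  l.foldr (fun i g x => fderiv ℝ g x (e i)) f

theorem SmoothNear.iterPartial {f : V → ℝ} (hf : SmoothNear f 0) (e : σ → V) (l : List σ) :
    SmoothNear (iterPartial e l f) 0 := by
  induction l with
  | nil => exact hf
  | cons i l ih => exact ih.fderiv.clm_apply (contDiff_const.smoothNear 0)

theorem iteratedFDeriv_eq_iterPartial {f : V → ℝ} (hf : SmoothNear f 0) (e : σ → V) (l : List σ) :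
    ∀ᶠ x in 𝓝 0, iteratedFDeriv ℝ l.length f x (fun k => e (l.get k)) = iterPartial e l f x := by
  induction l with
  | nil => simp [iterPartial]
  | cons i l ih =>
    filter_upwards [ih.eventually_nhds, hf] with x hx hfx
    have hd : DifferentiableAt ℝ (iteratedFDeriv ℝ l.length f) x :=
      hfx.differentiableAt_iteratedFDeriv (by exact_mod_cast WithTop.coe_lt_top _)
    refine (hd.iteratedFDeriv_succ_apply_left'
      (m := fun k : Fin (l.length + 1) => e ((i :: l).get k))).trans ?_
    exact congrArg (fun L : V →L[ℝ] ℝ => L (e i)) (EventuallyEq.fderiv_eq (𝕜 := ℝ) hx)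

theorem iterPartial_perm {f : V → ℝ} (hf : SmoothNear f 0) (e : σ → V) {l l' : List σ}
    (h : l.Perm l') : iterPartial e l f =ᶠ[𝓝 0] iterPartial e l' f := by
  induction h with
  | nil => rfl
  | cons i _ ih =>
    filter_upwards [ih.fderiv (𝕜 := ℝ)] with x hx
    exact congrArg (fun L : V →L[ℝ] ℝ => L (e i)) hx
  | swap i j l =>
    filter_upwards [hf.iterPartial e l, (hf.iterPartial e l).fderiv] with x hx hx'
    have hd : DifferentiableAt ℝ (fderiv ℝ (iterPartial e l f)) x :=
      hx'.differentiableAt (by simp)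
    have key : ∀ i j : σ, iterPartial e (i :: j :: l) f x =
        fderiv ℝ (fderiv ℝ (iterPartial e l f)) x (e i) (e j) := fun i j => by
      change fderiv ℝ (fun y => fderiv ℝ (iterPartial e l f) y (e j)) x (e i) = _
      rw [fderiv_clm_apply hd (differentiableAt_const _)]
      simp
    rw [key, key]
    exact ((contDiffAt_infty.1 hx 2).isSymmSndFDerivAt (by simp)).eq _ _
  | trans _ _ ih₁ ih₂ => exact ih₁.trans ih₂

theorem coeff_taylorSeries {f : V → ℝ} (hf : SmoothNear f 0) (e : σ → V) (α : σ →₀ ℕ) :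
    MvPowerSeries.coeff α (taylorSeries e f) =
      (α.prod fun _ k => (k.factorial : ℝ))⁻¹ * iterPartial e α.toMultiset.toList f 0 := by
  rw [← (iteratedFDeriv_eq_iterPartial hf e _).self_of_nhds]
  rfl

theorem constantCoeff_taylorSeries (e : σ → V) (f : V → ℝ) :
    MvPowerSeries.constantCoeff (taylorSeries e f) = f 0 := by
  rw [← MvPowerSeries.coeff_zero_eq_constantCoeff_apply]
  change (Finsupp.prod 0 _)⁻¹ * iteratedFDeriv ℝ
    (Finsupp.toMultiset (0 : σ →₀ ℕ)).toList.length f 0 _ = _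
  have : ∀ (l : List σ) (_ : l = []),
      iteratedFDeriv ℝ l.length f 0 (fun k => e (l.get k)) = f 0 := by
    rintro l rfl
    simp
  rw [Finsupp.prod_zero_index, inv_one, one_mul]
  exact this _ (by simp)

theorem taylorSeries_congr {f g : V → ℝ} (e : σ → V)
    (h : ∀ k, iteratedFDeriv ℝ k f 0 = iteratedFDeriv ℝ k g 0) :
    taylorSeries e f = taylorSeries e g := by
  funext α
  simp only [taylorSeries, h]

theorem taylorSeries_partial [Fintype σ] {f : V → ℝ} (hf : SmoothNear f 0) (e : σ → V) (i : σ) :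
    taylorSeries e (fun x => fderiv ℝ f x (e i)) =
      MvPowerSeries.pderiv ℝ i (taylorSeries e f) := by
  classical
  ext α
  rw [MvPowerSeries.coeff_pderiv, coeff_taylorSeries hf, coeff_taylorSeries
    (hf.fderiv.clm_apply (contDiff_const.smoothNear 0))]
  have hperm : (Finsupp.toMultiset (α + Finsupp.single i 1)).toList.Perm
      ((Finsupp.toMultiset α).toList ++ [i]) := by
    rw [← Multiset.coe_eq_coe, Multiset.coe_toList, ← Multiset.coe_add, Multiset.coe_toList, map_add,
      Finsupp.toMultiset_single, one_smul, Multiset.coe_singleton]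
  have happ : iterPartial e ((Finsupp.toMultiset α).toList ++ [i]) f =
      iterPartial e (Finsupp.toMultiset α).toList fun x => fderiv ℝ f x (e i) := by
    rw [iterPartial, List.foldr_append]
    rfl
  have hfac : ((α + Finsupp.single i 1).prod fun _ k => (k.factorial : ℝ)) =
      (α i + 1) * α.prod fun _ k => (k.factorial : ℝ) := by
    rw [Finsupp.prod_fintype _ _ (by simp), Finsupp.prod_fintype _ _ (by simp),
      ← Finset.mul_prod_erase Finset.univ _ (Finset.mem_univ i),
      ← Finset.mul_prod_erase Finset.univ (fun j => ((α j).factorial : ℝ)) (Finset.mem_univ i),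
      ← mul_assoc]
    congr 1
    · simp [Nat.factorial_succ]
    · refine Finset.prod_congr rfl fun j hj => ?_
      simp [Finsupp.single_eq_of_ne (Finset.ne_of_mem_erase hj)]
  rw [(iterPartial_perm hf e hperm).self_of_nhds, happ, hfac]
  have : (α i : ℝ) + 1 ≠ 0 := by positivity
  field_simp

end TaylorSeries

/-! ### Asymptotic expansions -/

section Expansion

variable {σ V : Type} [NormedAddCommGroup V] [NormedSpace ℝ V] (c : σ → V →L[ℝ] ℝ)

/-- `f` agrees with `S` up to order `N`: it is, up to `O(‖z‖ ^ N)`, a polynomial that has the same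
coefficients as `S` in all degrees less than `N`. -/
def HasExpansion (N : ℕ) (f : V → ℝ) (S : MvPowerSeries σ ℝ) : Prop :=
  ∃ P : MvPolynomial σ ℝ, (N : ℕ∞) ≤ (S - (P : MvPowerSeries σ ℝ)).order ∧
    (fun z => f z - MvPolynomial.eval (fun i => c i z) P) =O[𝓝 0] fun z => ‖z‖ ^ N

variable {c}

theorem hasExpansion_mvPolynomial (N : ℕ) (P : MvPolynomial σ ℝ) :
    HasExpansion c N (fun z => MvPolynomial.eval (fun i => c i z) P) P :=
  ⟨P, by simp, by simpa using Asymptotics.isBigO_zero _ _⟩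

theorem HasExpansion.add {N : ℕ} {f g : V → ℝ} {S T : MvPowerSeries σ ℝ}
    (hf : HasExpansion c N f S) (hg : HasExpansion c N g T) :
    HasExpansion c N (fun z => f z + g z) (S + T) := by
  obtain ⟨P, hP, hfP⟩ := hf
  obtain ⟨Q, hQ, hgQ⟩ := hg
  refine ⟨P + Q, ?_, ?_⟩
  · rw [MvPolynomial.coe_add, add_sub_add_comm]
    exact (le_min hP hQ).trans MvPowerSeries.min_order_le_add
  · simpa only [map_add, add_sub_add_comm] using hfP.add hgQ

variable [Fintype σ] (c)

theorem hasFDerivAt_mvPolynomial (P : MvPolynomial σ ℝ) (z : V) :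
    HasFDerivAt (fun z => MvPolynomial.eval (fun i => c i z) P)
      (∑ i, MvPolynomial.eval (fun i => c i z) (MvPolynomial.pderiv i P) • c i) z := by
  classical
  induction P using MvPolynomial.induction_on with
  | C a => simpa using hasFDerivAt_const a z
  | add p q hp hq =>
    simpa only [map_add, add_smul, Finset.sum_add_distrib] using hp.fun_add hq
  | mul_X p j hp =>
    simp only [map_mul, MvPolynomial.eval_X]
    refine (hp.mul (c j).hasFDerivAt).congr_fderiv ?_
    ext v
    simp [Derivation.leibniz, MvPolynomial.pderiv_X, Pi.single_apply, add_mul,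
      Finset.sum_add_distrib, Finset.mul_sum, mul_assoc, apply_ite]

theorem isBigO_one_mvPolynomial (P : MvPolynomial σ ℝ) :
    (fun z => MvPolynomial.eval (fun i => c i z) P) =O[𝓝 0] fun _ => (1 : ℝ) :=
  (hasFDerivAt_mvPolynomial c P 0).continuousAt.isBigO_one ℝ

theorem pderiv_truncTotal_succ (S : MvPowerSeries σ ℝ) (N : ℕ) (i : σ) :
    MvPolynomial.pderiv i (S.truncTotal (N + 1)) =
      (MvPowerSeries.pderiv ℝ i S).truncTotal N := by
  classical
  refine MvPolynomial.coe_injective _ _ ?_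
  ext α
  rw [← MvPowerSeries.pderiv_coe, MvPowerSeries.coeff_pderiv, MvPolynomial.coeff_coe,
    MvPolynomial.coeff_coe, MvPowerSeries.coeff_truncTotal_eq_ite,
    MvPowerSeries.coeff_truncTotal_eq_ite, MvPowerSeries.coeff_pderiv]
  simp [Finsupp.degree_single, ite_mul]

variable {c}

/-- Taylor's theorem: a smooth function differs from its Taylor polynomial of degree less than `N`
by `O(‖z‖ ^ N)`. By `taylorSeries_partial` the estimate for the partial derivatives is an instance
of the same statement for `N - 1`. -/
theorem isBigO_sub_truncTotal_taylorSeries {e : σ → V} (hc : ∀ z, ∑ i, c i z • e i = z) (N : ℕ)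
    {f : V → ℝ} (hf : SmoothNear f 0) :
    (fun z => f z - MvPolynomial.eval (fun i => c i z) ((taylorSeries e f).truncTotal N))
      =O[𝓝 0] fun z => ‖z‖ ^ N := by
  induction N generalizing f with
  | zero =>
    simp only [pow_zero]
    exact (hf.continuousAt.isBigO_one ℝ).sub (isBigO_one_mvPolynomial c _)
  | succ N ih =>
    have hP := hasFDerivAt_mvPolynomial c ((taylorSeries e f).truncTotal (N + 1))
    refine isBigO_norm_pow_succ_of_fderiv ?_ ?_ ?_
    · filter_upwards [hf.differentiableAt] with z hz using hz.sub (hP z).differentiableAt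
    · simp only [map_zero]
      rw [← Pi.zero_def, MvPolynomial.eval_zero, MvPowerSeries.constantCoeff_truncTotal_eq_ite,
        if_pos N.succ_pos, constantCoeff_taylorSeries, sub_self]
    · have hfd : fderiv ℝ (fun z => f z -
          MvPolynomial.eval (fun i => c i z) ((taylorSeries e f).truncTotal (N + 1))) =ᶠ[𝓝 0]
          fun z => ∑ i, (fderiv ℝ f z (e i) - MvPolynomial.eval (fun i => c i z)
            ((taylorSeries e fun x => fderiv ℝ f x (e i)).truncTotal N)) • c i := by
        filter_upwards [hf.differentiableAt] with z hz
        rw [(hz.hasFDerivAt.fun_sub (hP z)).fderiv]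
        ext v
        have hv : fderiv ℝ f z v = ∑ i, c i v * fderiv ℝ f z (e i) := by
          conv_lhs => rw [← hc v]
          simp
        simp only [sub_apply, sum_apply, smul_apply, smul_eq_mul, hv,
          ← Finset.sum_sub_distrib, taylorSeries_partial hf, pderiv_truncTotal_succ]
        exact Finset.sum_congr rfl fun i _ => by ring
      refine hfd.trans_isBigO (Asymptotics.IsBigO.fun_sum fun i _ => ?_)
      have := (ih (f := fun x => fderiv ℝ f x (e i))
        (hf.fderiv.clm_apply (contDiff_const.smoothNear 0))).smul
          (Asymptotics.isBigO_const_const (c i) (one_ne_zero (α := ℝ)) (𝓝 (0 : V)))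
      simpa using this

/-- A polynomial of order at least `N` is `O(‖z‖ ^ N)`. -/
theorem isBigO_mvPolynomial_of_le_order {N : ℕ} {P : MvPolynomial σ ℝ}
    (hP : (N : ℕ∞) ≤ (P : MvPowerSeries σ ℝ).order) :
    (fun z => MvPolynomial.eval (fun i => c i z) P) =O[𝓝 0] fun z => ‖z‖ ^ N := by
  simp only [MvPolynomial.eval_eq']
  refine Asymptotics.IsBigO.fun_sum fun α hα => Asymptotics.IsBigO.const_mul_left ?_ _
  have hdeg : N ≤ ∑ i, α i := by
    have h1 : MvPowerSeries.coeff α (P : MvPowerSeries σ ℝ) ≠ 0 := by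
      rw [MvPolynomial.coeff_coe]
      exact MvPolynomial.mem_support_iff.1 hα
    have h2 := hP.trans (MvPowerSeries.order_le h1)
    rw [Finsupp.degree_eq_sum] at h2
    exact_mod_cast h2
  refine Asymptotics.IsBigO.trans ?_ (isBigO_norm_pow_of_le hdeg)
  simp only [← Finset.prod_pow_eq_pow_sum]
  exact Asymptotics.IsBigO.finsetProd fun i _ => ((c i).isBigO_id _).norm_right.pow _

theorem le_order_sub_truncTotal (S : MvPowerSeries σ ℝ) (N : ℕ) :
    (N : ℕ∞) ≤ (S - (S.truncTotal N : MvPowerSeries σ ℝ)).order := by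
  refine MvPowerSeries.le_order fun α hα => ?_
  rw [map_sub, MvPolynomial.coeff_coe, MvPowerSeries.coeff_truncTotal _ (by exact_mod_cast hα),
    sub_self]

theorem hasExpansion_taylorSeries {e : σ → V} (hc : ∀ z, ∑ i, c i z • e i = z) (N : ℕ)
    {f : V → ℝ} (hf : SmoothNear f 0) : HasExpansion c N f (taylorSeries e f) :=
  ⟨_, le_order_sub_truncTotal _ N, isBigO_sub_truncTotal_taylorSeries hc N hf⟩

theorem HasExpansion.mul {N : ℕ} {f g : V → ℝ} {S T : MvPowerSeries σ ℝ}
    (hf : HasExpansion c N f S) (hg : HasExpansion c N g T) :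
    HasExpansion c N (fun z => f z * g z) (S * T) := by
  obtain ⟨P, hP, hfP⟩ := hf
  obtain ⟨Q, hQ, hgQ⟩ := hg
  refine ⟨P * Q, ?_, ?_⟩
  · have : S * T - ((P * Q : MvPolynomial σ ℝ) : MvPowerSeries σ ℝ) = S * (T - Q) + (S - P) * Q := by
      rw [MvPolynomial.coe_mul]
      ring
    rw [this]
    refine (le_min ?_ ?_).trans MvPowerSeries.min_order_le_add
    · exact hQ.trans (le_add_self.trans MvPowerSeries.le_order_mul)
    · exact hP.trans (le_self_add.trans MvPowerSeries.le_order_mul)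
  · have hf1 : f =O[𝓝 0] fun _ => (1 : ℝ) := by
      have h1 : (fun z : V => ‖z‖ ^ N) =O[𝓝 0] fun _ => (1 : ℝ) := by
        simpa using isBigO_norm_pow_of_le (V := V) N.zero_le
      simpa using (hfP.trans h1).add (isBigO_one_mvPolynomial c P)
    have h1 := hf1.mul hgQ
    have h2 := hfP.mul (isBigO_one_mvPolynomial c Q)
    simp only [one_mul, mul_one] at h1 h2
    refine (h1.add h2).congr_left fun z => ?_
    rw [map_mul]
    ring

/-- Expansions may be substituted into polynomials. -/
theorem HasExpansion.aeval {τ : Type} {N : ℕ} {f : τ → V → ℝ} {S : τ → MvPowerSeries σ ℝ}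
    (hf : ∀ j, HasExpansion c N (f j) (S j)) (Q : MvPolynomial τ ℝ) :
    HasExpansion c N (fun z => MvPolynomial.eval (fun j => f j z) Q) (MvPolynomial.aeval S Q) := by
  induction Q using MvPolynomial.induction_on with
  | C a => simpa [MvPowerSeries.algebraMap_apply] using
      hasExpansion_mvPolynomial (c := c) N (MvPolynomial.C a)
  | add p q hp hq => simpa only [map_add] using hp.add hq
  | mul_X p j hp => simpa using hp.mul (hf j)

theorem HasExpansion.isBigO {N : ℕ} {f : V → ℝ} {S : MvPowerSeries σ ℝ}
    (hf : HasExpansion c N f S) (hS : (N : ℕ∞) ≤ S.order) : f =O[𝓝 0] fun z => ‖z‖ ^ N := by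
  obtain ⟨P, hP, hfP⟩ := hf
  have h1 : (N : ℕ∞) ≤ (P : MvPowerSeries σ ℝ).order := by
    have : (P : MvPowerSeries σ ℝ) = S + -(S - P) := by ring
    rw [this]
    refine (le_min hS ?_).trans MvPowerSeries.min_order_le_add
    rwa [MvPowerSeries.order_neg]
  simpa using hfP.add (isBigO_mvPolynomial_of_le_order (c := c) h1)

/-- A function whose Taylor series is annihilated by a formal substitution becomes flat after
composition with a map that realizes this substitution. -/
theorem flat_comp_of_subst_eq_zero {τ U : Type} [Fintype τ] [NormedAddCommGroup U]
    [NormedSpace ℝ U] {c' : τ → U →L[ℝ] ℝ} {e : σ → V} {e' : τ → U}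
    (hc : ∀ z, ∑ i, c i z • e i = z) (hc' : ∀ z, ∑ i, c' i z • e' i = z)
    {F : U → ℝ} {ξ : V → U} (hξ : SmoothNear ξ 0) (h0 : ξ 0 = 0) (hF : SmoothNear F 0)
    (h : MvPowerSeries.subst (fun j => taylorSeries e fun x => c' j (ξ x)) (taylorSeries e' F) = 0) :
    Flat fun x => F (ξ x) := by
  intro N
  set S : τ → MvPowerSeries σ ℝ := fun j => taylorSeries e fun x => c' j (ξ x) with hS
  set T := taylorSeries e' F with hT
  have hS0 : ∀ j, MvPowerSeries.constantCoeff (S j) = 0 := fun j => by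
    rw [hS, constantCoeff_taylorSeries, h0, map_zero]
  have hsub : MvPowerSeries.HasSubst S := MvPowerSeries.hasSubst_of_constantCoeff_zero hS0
  have hfj : ∀ j, HasExpansion c N (fun x => c' j (ξ x)) (S j) := fun j =>
    hasExpansion_taylorSeries hc N (((c' j).contDiff.smoothNear _).comp hξ)
  have hord : (N : ℕ∞) ≤ (MvPolynomial.aeval S (T.truncTotal N)).order := by
    rw [← MvPowerSeries.subst_coe]
    have h1 : MvPowerSeries.subst S (T.truncTotal N : MvPowerSeries τ ℝ) =
        -MvPowerSeries.subst S (T - (T.truncTotal N : MvPowerSeries τ ℝ)) := by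
      rw [MvPowerSeries.subst_sub hsub, h, zero_sub, neg_neg]
    rw [h1, MvPowerSeries.order_neg]
    refine le_trans ?_ (MvPowerSeries.le_order_subst hsub _)
    have h2 : (1 : ℕ∞) ≤ ⨅ j, (S j).order := le_iInf fun j =>
      MvPowerSeries.one_le_order_iff_constCoeff_eq_zero.2 (hS0 j)
    calc (N : ℕ∞) = 1 * N := (one_mul _).symm
      _ ≤ _ := mul_le_mul' h2 (le_order_sub_truncTotal T N)
  have hA := (HasExpansion.aeval hfj (T.truncTotal N)).isBigO hord
  have hξO : (fun x => ‖ξ x‖) =O[𝓝 0] fun x : V => ‖x‖ := by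
    have := (hξ.contDiffAt.differentiableAt (by simp)).isBigO_sub
    simp only [h0, sub_zero] at this
    exact this.norm_norm
  have hlim : Tendsto ξ (𝓝 0) (𝓝 0) := by
    have := hξ.continuousAt
    rwa [ContinuousAt, h0] at this
  have hB := ((isBigO_sub_truncTotal_taylorSeries hc' N hF).comp_tendsto hlim).trans (hξO.pow N)
  refine (hB.add hA).congr_left fun x => ?_
  simp [hT]

end Expansion

/-! ### Inverse functions and quadratic perturbations of the identity -/

section Inverse

theorem isBigO_clm_apply {α V W : Type*} [TopologicalSpace α] [NormedAddCommGroup V]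
    [NormedSpace ℝ V] [NormedAddCommGroup W] [NormedSpace ℝ W] {L : α → V →L[ℝ] W} {v : α → V}
    {a : α} (hL : ContinuousAt L a) : (fun x => L x (v x)) =O[𝓝 a] v := by
  have h1 : (fun x => L x (v x)) =O[𝓝 a] fun x => ‖L x‖ * ‖v x‖ :=
    Asymptotics.isBigO_of_le _ fun x => by
      simpa using (L x).le_opNorm (v x)
  have h2 := (hL.norm.isBigO_one ℝ).mul (Asymptotics.isBigO_refl (fun x => ‖v x‖) (𝓝 a))
  simpa using h1.trans h2

/-- The inverse function theorem for smooth germs whose derivative is the identity. -/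
theorem exists_smooth_right_inverse {E : Type*} [NormedAddCommGroup E] [NormedSpace ℝ E]
    [CompleteSpace E] {Θ : E → E} {a : E} (hΘ : SmoothNear Θ a)
    (hd : HasFDerivAt Θ (ContinuousLinearMap.id ℝ E) a) :
    ∃ Ξ : E → E, SmoothNear Ξ (Θ a) ∧ Ξ (Θ a) = a ∧ ∀ᶠ z in 𝓝 (Θ a), Θ (Ξ z) = z := by
  have hd' : HasFDerivAt Θ ((ContinuousLinearEquiv.refl ℝ E : E ≃L[ℝ] E) : E →L[ℝ] E) a := hd
  set h := hΘ.contDiffAt.toOpenPartialHomeomorph Θ hd' (by simp) with hh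
  have hcoe : (h : E → E) = Θ := hΘ.contDiffAt.toOpenPartialHomeomorph_coe hd' (by simp)
  have hsrc : a ∈ h.source := hΘ.contDiffAt.mem_toOpenPartialHomeomorph_source hd' (by simp)
  have htgt : Θ a ∈ h.target := by
    have := h.map_source hsrc
    rwa [hcoe] at this
  have hinv : h.symm (Θ a) = a := by
    have := h.left_inv hsrc
    rwa [hcoe] at this
  have hlim : Tendsto h.symm (𝓝 (Θ a)) (𝓝 a) := by
    have := h.continuousAt_symm htgt
    rwa [ContinuousAt, hinv] at this
  have hequiv : ∀ᶠ z in 𝓝 a, fderiv ℝ Θ z ∈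
      Set.range (ContinuousLinearEquiv.toContinuousLinearMap : (E ≃L[ℝ] E) → E →L[ℝ] E) := by
    refine hΘ.fderiv.continuousAt.eventually ?_
    rw [hd'.fderiv]
    exact ContinuousLinearEquiv.nhds _
  have htgt' : ∀ᶠ z in 𝓝 (Θ a), z ∈ h.target := h.open_target.mem_nhds htgt
  refine ⟨h.symm, ?_, hinv, ?_⟩
  · filter_upwards [htgt', hlim.eventually hΘ, hlim.eventually hequiv] with z h1 h2 h3
    obtain ⟨L, hL⟩ := h3
    refine h.contDiffAt_symm (f₀' := L) h1 ?_ (by rwa [hcoe])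
    rw [hcoe, hL]
    exact (h2.differentiableAt (by simp)).hasFDerivAt
  · filter_upwards [htgt'] with z hz
    have := h.right_inv hz
    rwa [hcoe] at this

/-- The equation `w + Q(x, w) = g(x)` with `Q` of order two has a smooth solution germ. -/
theorem exists_smooth_solution {V W : Type} [NormedAddCommGroup V] [NormedSpace ℝ V]
    [CompleteSpace V] [NormedAddCommGroup W] [NormedSpace ℝ W] [CompleteSpace W]
    {Q : V × W → W} (hQ : SmoothNear Q 0) (hQ2 : Q =O[𝓝 0] fun z => ‖z‖ ^ 2)
    {g : V → W} (hg : SmoothNear g 0) (hg0 : g 0 = 0) :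
    ∃ w : V → W, SmoothNear w 0 ∧ w 0 = 0 ∧ ∀ᶠ x in 𝓝 0, w x + Q (x, w x) = g x := by
  let Θ : V × W → V × W := fun z => (z.1, z.2 + Q z)
  have hQd := hasFDerivAt_zero_of_isBigO hQ2
  have hQ0 : Q 0 = 0 := by
    obtain ⟨C, hC⟩ := hQ2.bound
    simpa using hC.self_of_nhds
  have hΘ0 : Θ 0 = 0 := by simp [Θ, hQ0]
  have hΘ : SmoothNear Θ 0 :=
    (contDiff_fst.smoothNear 0).prodMk ((contDiff_snd.smoothNear 0).add hQ)
  have hd : HasFDerivAt Θ (ContinuousLinearMap.id ℝ (V × W)) 0 := by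
    refine (hasFDerivAt_fst.prodMk (hasFDerivAt_snd.add hQd)).congr_fderiv ?_
    ext <;> simp
  obtain ⟨Ξ, hΞ, hΞ0, hinv⟩ := exists_smooth_right_inverse hΘ hd
  rw [hΘ0] at hΞ hΞ0 hinv
  have hgr : SmoothNear (fun x => (x, g x)) (0 : V) := (contDiff_id.smoothNear 0).prodMk hg
  have hgr0 : ((0 : V), g 0) = 0 := by rw [hg0]; rfl
  have hΞg : SmoothNear (fun x => Ξ (x, g x)) (0 : V) :=
    SmoothNear.comp (f := Ξ) (g := fun x => (x, g x)) (by rwa [hgr0]) hgr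
  refine ⟨fun x => (Ξ (x, g x)).2, (contDiff_snd.smoothNear _).comp hΞg, ?_, ?_⟩
  · simp only [hgr0, hΞ0]
    rfl
  · have hlim : Tendsto (fun x => (x, g x)) (𝓝 (0 : V)) (𝓝 0) := by
      have := hgr.continuousAt
      rwa [ContinuousAt, hgr0] at this
    filter_upwards [hlim.eventually hinv] with x hx
    have h1 : (Ξ (x, g x)).1 = x := congrArg Prod.fst hx
    have h2 : (Ξ (x, g x)).2 + Q (Ξ (x, g x)) = g x := congrArg Prod.snd hx
    have h3 : (x, (Ξ (x, g x)).2) = Ξ (x, g x) := Prod.ext h1.symm rfl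
    rw [h3, h2]

end Inverse

/-! ### A right inverse of the Jacobian matrix up to the factor `d` -/

section RightInverse

theorem smoothNear_det {V : Type*} [NormedAddCommGroup V] [NormedSpace ℝ V] {a : V} {p : ℕ}
    {M : V → Matrix (Fin p) (Fin p) ℝ} (hM : ∀ i j, SmoothNear (fun x => M x i j) a) :
    SmoothNear (fun x => (M x).det) a := by
  have hM' : ∀ᶠ x in 𝓝 a, ∀ i j, ContDiffAt ℝ ∞ (fun x => M x i j) x :=
    eventually_all.2 fun i => eventually_all.2 fun j => hM i j
  filter_upwards [hM'] with x hx
  simp only [Matrix.det_apply']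
  exact ContDiffAt.sum fun s _ => contDiffAt_const.mul (contDiffAt_prod fun i _ => hx _ _)

theorem SmoothNear.sum {ι V W : Type*} [NormedAddCommGroup V] [NormedSpace ℝ V]
    [NormedAddCommGroup W] [NormedSpace ℝ W] [Fintype ι] {a : V} {f : ι → V → W}
    (hf : ∀ i, SmoothNear (f i) a) : SmoothNear (fun x => ∑ i, f i x) a := by
  filter_upwards [eventually_all.2 hf] with x hx using ContDiffAt.sum fun i _ => hx i

theorem smoothNear_matrix_mul {V : Type*} [NormedAddCommGroup V] [NormedSpace ℝ V] {a : V}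
    {p q r : ℕ} {M : V → Matrix (Fin p) (Fin q) ℝ} {N : V → Matrix (Fin q) (Fin r) ℝ}
    (hM : ∀ i j, SmoothNear (fun x => M x i j) a) (hN : ∀ i j, SmoothNear (fun x => N x i j) a)
    (i : Fin p) (j : Fin r) : SmoothNear (fun x => (M x * N x) i j) a := by
  simp only [Matrix.mul_apply]
  exact SmoothNear.sum fun k => (hM i k).smul (hN k j)

theorem smoothNear_adjugate {V : Type*} [NormedAddCommGroup V] [NormedSpace ℝ V] {a : V} {p : ℕ}
    {M : V → Matrix (Fin p) (Fin p) ℝ} (hM : ∀ i j, SmoothNear (fun x => M x i j) a)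
    (i j : Fin p) : SmoothNear (fun x => (M x).adjugate i j) a := by
  simp only [Matrix.adjugate_apply]
  refine smoothNear_det fun k l => ?_
  by_cases hk : k = j
  · subst hk
    simpa using contDiff_const.smoothNear a
  · simpa [Matrix.updateRow_ne hk] using hM k l

variable {m n p : ℕ}
  {F : EuclideanSpace ℝ (Fin m) × EuclideanSpace ℝ (Fin n) → EuclideanSpace ℝ (Fin p)}
  {y₀ : EuclideanSpace ℝ (Fin m) → EuclideanSpace ℝ (Fin n)}

theorem tendsto_graph (hy : SmoothNear y₀ 0) (h0 : y₀ 0 = 0) :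
    Tendsto (fun x => (x, y₀ x)) (𝓝 0) (𝓝 0) := by
  have := (continuousAt_id (x := (0 : EuclideanSpace ℝ (Fin m)))).prodMk hy.continuousAt
  simp only [ContinuousAt, id, h0] at this
  exact this

theorem smoothNear_jacobianY (hF : SmoothNear F 0) (hy : SmoothNear y₀ 0) (h0 : y₀ 0 = 0)
    (i : Fin p) (j : Fin n) : SmoothNear (fun x => jacobianY F y₀ x i j) 0 := by
  filter_upwards [(tendsto_graph hy h0).eventually hF, hy] with x h1 h2
  have h3 : ContDiffAt ℝ ∞ (fun x => fderiv ℝ (fun y => F (x, y)) (y₀ x)) x :=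
    ContDiffAt.fderiv (f := fun x y => F (x, y)) (n := ∞) h1 h2 (by simp)
  exact (EuclideanSpace.proj (𝕜 := ℝ) i).contDiff.contDiffAt.comp x
    (h3.clm_apply contDiffAt_const)

theorem sum_smul_stdBasis (z : EuclideanSpace ℝ (Fin m)) : ∑ i, z i • stdBasis m i = z := by
  ext j
  simp [stdBasis, Pi.single_apply]

/-- The operator `Aᵀ adj(A Aᵀ)`, for `A` the Jacobian matrix in `y`, is a smooth right inverse of
`A` up to the factor `det (A Aᵀ)`. -/
theorem exists_right_inverse (hF : SmoothNear F 0) (hy : SmoothNear y₀ 0) (h0 : y₀ 0 = 0) :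
    ∃ B : EuclideanSpace ℝ (Fin m) → EuclideanSpace ℝ (Fin p) →L[ℝ] EuclideanSpace ℝ (Fin n),
      SmoothNear B 0 ∧
      ∀ x w, fderiv ℝ (fun y => F (x, y)) (y₀ x) (B x w) = gramDet F y₀ x • w := by
  let A := jacobianY F y₀
  let M : EuclideanSpace ℝ (Fin m) → Matrix (Fin n) (Fin p) ℝ := fun x =>
    (A x).transpose * (A x * (A x).transpose).adjugate
  have hA : ∀ i j, SmoothNear (fun x => A x i j) 0 := smoothNear_jacobianY hF hy h0
  have hM : ∀ j i, SmoothNear (fun x => M x j i) 0 :=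
    smoothNear_matrix_mul (fun i j => hA j i)
      (smoothNear_adjugate (smoothNear_matrix_mul hA fun i j => hA j i))
  refine ⟨fun x => ∑ j, ∑ i, M x j i •
      (EuclideanSpace.proj (𝕜 := ℝ) i).smulRight (stdBasis n j),
    SmoothNear.sum fun j => SmoothNear.sum fun i => (hM j i).smul (contDiff_const.smoothNear 0),
    fun x w => ?_⟩
  have hAM : A x * M x = gramDet F y₀ x • (1 : Matrix (Fin p) (Fin p) ℝ) := by
    rw [← Matrix.mul_assoc, Matrix.mul_adjugate]
    rfl
  ext k
  have hk : ∀ i, ∑ j, A x k j * M x j i = gramDet F y₀ x * (1 : Matrix (Fin p) (Fin p) ℝ) k i :=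
    fun i => by
      rw [← Matrix.mul_apply, hAM]
      rfl
  have hL : ∀ j, fderiv ℝ (fun y => F (x, y)) (y₀ x) (stdBasis n j) k = A x k j := fun j => rfl
  simp only [sum_apply, smul_apply, ContinuousLinearMap.smulRight_apply, map_sum, map_smul,
    PiLp.proj_apply, WithLp.ofLp_sum, WithLp.ofLp_smul, Finset.sum_apply, Pi.smul_apply,
    smul_eq_mul, hL]
  rw [Finset.sum_comm]
  calc ∑ i, ∑ j, M x j i * (w i * A x k j) = ∑ i, (∑ j, A x k j * M x j i) * w i :=
        Finset.sum_congr rfl fun i _ => by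
          rw [Finset.sum_mul]
          exact Finset.sum_congr rfl fun j _ => by ring
    _ = gramDet F y₀ x * w k := by
        simp [hk, Matrix.one_apply]

end RightInverse

/-! ### Solving the equation -/

section Solution

variable {m n p : ℕ}
  {F : EuclideanSpace ℝ (Fin m) × EuclideanSpace ℝ (Fin n) → EuclideanSpace ℝ (Fin p)}
  {y₀ : EuclideanSpace ℝ (Fin m) → EuclideanSpace ℝ (Fin n)}

theorem taylorSeries_zero {σ V : Type} [NormedAddCommGroup V] [NormedSpace ℝ V] (e : σ → V) :
    taylorSeries e (fun _ => (0 : ℝ)) = 0 := by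
  ext α
  rw [coeff_taylorSeries (contDiff_const.smoothNear 0),
    ← (iteratedFDeriv_eq_iterPartial (contDiff_const.smoothNear 0) e _).self_of_nhds]
  simp

theorem taylorSeries_const {σ V : Type} [Fintype σ] [NormedAddCommGroup V] [NormedSpace ℝ V]
    (e : σ → V) (a : ℝ) : taylorSeries e (fun _ => a) = MvPowerSeries.C a := by
  refine MvPowerSeries.pderiv.ext (fun i => ?_) (by simp [constantCoeff_taylorSeries])
  rw [← taylorSeries_partial (contDiff_const.smoothNear 0)]
  simp [taylorSeries_zero]

theorem taylorSeries_coord (k : Fin m) :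
    taylorSeries (stdBasis m) (fun x => x k) = MvPowerSeries.X k := by
  classical
  have hs : SmoothNear (fun x : EuclideanSpace ℝ (Fin m) => x k) 0 :=
    (EuclideanSpace.proj (𝕜 := ℝ) k).contDiff.smoothNear 0
  refine MvPowerSeries.pderiv.ext (fun i => ?_) (by simp [constantCoeff_taylorSeries])
  rw [← taylorSeries_partial hs]
  have : (fun x => fderiv ℝ (fun x : EuclideanSpace ℝ (Fin m) => x k) x (stdBasis m i)) =
      fun _ => if k = i then 1 else 0 := by
    funext x
    have h1 := (EuclideanSpace.proj k : EuclideanSpace ℝ (Fin m) →L[ℝ] ℝ).hasFDerivAt (x := x)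
    have h2 : fderiv ℝ (fun x : EuclideanSpace ℝ (Fin m) => x k) x =
        EuclideanSpace.proj (𝕜 := ℝ) k := h1.fderiv
    rw [h2]
    simp [stdBasis]
  rw [this, taylorSeries_const, MvPowerSeries.pderiv_X]
  split_ifs <;> simp_all [eq_comm]

/-- The Taylor series of a realization being a formal solution, `x ↦ F(x, y₀(x))` is flat. -/
theorem IsFormalSolution.flat {ŷ : Fin n → MvPowerSeries (Fin m) ℝ} (hŷ : IsFormalSolution F ŷ)
    (hF : SmoothNear F 0) (hy : IsRealization ŷ y₀) : Flat fun x => F (x, y₀ x) := by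
  have hcomp : ∀ i, Flat fun x => F (x, y₀ x) i := by
    intro i
    refine flat_comp_of_subst_eq_zero (ξ := fun x => (x, y₀ x)) (F := fun z => F z i)
      (c := fun i => EuclideanSpace.proj (𝕜 := ℝ) i) (e := stdBasis m)
      (c' := Sum.elim
        (fun i => (EuclideanSpace.proj (𝕜 := ℝ) i).comp (ContinuousLinearMap.fst ℝ _ _))
        (fun j => (EuclideanSpace.proj (𝕜 := ℝ) j).comp (ContinuousLinearMap.snd ℝ _ _)))
      (e' := stdBasisProd m n) sum_smul_stdBasis (fun z => ?_)
      ((contDiff_id.smoothNear 0).prodMk hy.1) (by simp [hy.2.1])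
      (((EuclideanSpace.proj (𝕜 := ℝ) i).contDiff.smoothNear _).comp hF) ?_
    · refine Prod.ext ?_ ?_
      · simpa [stdBasisProd, Prod.fst_sum] using sum_smul_stdBasis z.1
      · simpa [stdBasisProd, Prod.snd_sum] using sum_smul_stdBasis z.2
    · rw [← hŷ.2 i]
      congr 1
      funext j
      rcases j with k | j
      · exact taylorSeries_coord k
      · exact hy.2.2 j
  intro N
  have hsum : (fun x => F (x, y₀ x)) = fun x => ∑ i, F (x, y₀ x) i • stdBasis p i :=
    funext fun x => (sum_smul_stdBasis _).symm
  rw [hsum]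
  refine Asymptotics.IsBigO.fun_sum fun i _ => ?_
  simpa using (hcomp i N).smul
    (Asymptotics.isBigO_const_const (stdBasis p i) (one_ne_zero (α := ℝ)) (𝓝 0))

theorem IsRealization.add_flat {ŷ : Fin n → MvPowerSeries (Fin m) ℝ} (hy : IsRealization ŷ y₀)
    {z : EuclideanSpace ℝ (Fin m) → EuclideanSpace ℝ (Fin n)} (hz : SmoothNear z 0)
    (hflat : Flat z) : IsRealization ŷ fun x => y₀ x + z x := by
  refine ⟨hy.1.add hz, by simp [hy.2.1, hflat.apply_zero], fun j => ?_⟩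
  rw [← hy.2.2 j]
  refine taylorSeries_congr _ fun k => ?_
  have h1 : SmoothNear (fun x => y₀ x j) 0 :=
    ((EuclideanSpace.proj (𝕜 := ℝ) j).contDiff.smoothNear _).comp hy.1
  have h2 : SmoothNear (fun x => z x j) 0 :=
    ((EuclideanSpace.proj (𝕜 := ℝ) j).contDiff.smoothNear _).comp hz
  have h3 : Flat fun x => z x j := fun N =>
    (Asymptotics.isBigO_of_le _ fun x => PiLp.norm_apply_le (z x) j).trans (hflat N)
  have h4 := iteratedFDeriv_add_apply (𝕜 := ℝ) (i := k) (contDiffAt_infty.1 h1.contDiffAt k)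
    (contDiffAt_infty.1 h2.contDiffAt k)
  rw [h3.iteratedFDeriv_eq_zero h2, add_zero] at h4
  exact h4

/-- If `F(x, y₀(x))` is flat and `d` satisfies the Łojasiewicz condition, then `y₀` can be changed
by a flat map into a solution. With `d² f = F(x, y₀)` and `u = d B w`, where `B` is the right
inverse of the Jacobian up to `d`, the equation `F(x, y₀ + u) = 0` becomes
`d² (f + w + Q(x, w)) = 0` with `Q` quadratic in `w`. -/
theorem exists_flat_correction (hF : SmoothNear F 0) (hy : SmoothNear y₀ 0) (h0 : y₀ 0 = 0)
    (hflat : Flat fun x => F (x, y₀ x)) (hdom : DominatesPow (gramDet F y₀)) :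
    ∃ u : EuclideanSpace ℝ (Fin m) → EuclideanSpace ℝ (Fin n), SmoothNear u 0 ∧ Flat u ∧
      ∀ᶠ x in 𝓝 0, F (x, y₀ x + u x) = 0 := by
  set d := gramDet F y₀ with hd
  have hds : SmoothNear d 0 := smoothNear_gramDet hF hy h0
  obtain ⟨B, hB, hAB⟩ := exists_right_inverse hF hy h0
  obtain ⟨G, hG, hGF⟩ := hF.exists_contDiff
  obtain ⟨R, hR, hRG⟩ := exists_quadratic_remainder hG
  have hgr : SmoothNear (fun x => (x, y₀ x)) 0 := (contDiff_id.smoothNear 0).prodMk hy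
  have hlim := tendsto_graph hy h0
  have hFs : SmoothNear (fun x => F (x, y₀ x)) 0 :=
    SmoothNear.comp (f := F) (g := fun x => (x, y₀ x)) (by rwa [h0]) hgr
  -- The equation in `w`, after division by `d²`.
  set f := fun x => (d x * d x)⁻¹ • F (x, y₀ x) with hf
  have hf_flat : Flat f := hflat.inv_smul (hdom.mul hdom)
  have hf_smooth : SmoothNear f 0 :=
    SmoothNear.inv_smul_of_flat (hdom.mul hdom) (hds.smul hds) hflat hFs
  set Q : EuclideanSpace ℝ (Fin m) × EuclideanSpace ℝ (Fin p) → EuclideanSpace ℝ (Fin p) :=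
    fun z => R ((z.1, y₀ z.1), d z.1 • B z.1 z.2) (B z.1 z.2) (B z.1 z.2) with hQdef
  have hfst : SmoothNear (Prod.fst : EuclideanSpace ℝ (Fin m) × EuclideanSpace ℝ (Fin p) → _) 0 :=
    contDiff_fst.smoothNear 0
  have hB1 : SmoothNear (fun z : EuclideanSpace ℝ (Fin m) × EuclideanSpace ℝ (Fin p) => B z.1) 0 :=
    SmoothNear.comp (f := B) (g := Prod.fst) hB hfst
  have hBw : SmoothNear
      (fun z : EuclideanSpace ℝ (Fin m) × EuclideanSpace ℝ (Fin p) => B z.1 z.2) 0 :=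
    hB1.clm_apply (contDiff_snd.smoothNear 0)
  have hRQ : SmoothNear (fun z : EuclideanSpace ℝ (Fin m) × EuclideanSpace ℝ (Fin p) =>
      R ((z.1, y₀ z.1), d z.1 • B z.1 z.2)) 0 :=
    (hR.smoothNear _).comp ((SmoothNear.comp (f := fun x => (x, y₀ x)) (g := Prod.fst) hgr
      hfst).prodMk
      ((SmoothNear.comp (f := d) (g := Prod.fst) hds hfst).smul hBw))
  have hQ : SmoothNear Q 0 := (hRQ.clm_apply hBw).clm_apply hBw
  have hquad : Q =O[𝓝 0] fun z => ‖z.2‖ ^ 2 := by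
    have h1 : (fun z : EuclideanSpace ℝ (Fin m) × EuclideanSpace ℝ (Fin p) => B z.1 z.2)
        =O[𝓝 0] fun z => z.2 := isBigO_clm_apply hB1.continuousAt
    have h2 : (fun z : EuclideanSpace ℝ (Fin m) × EuclideanSpace ℝ (Fin p) =>
        R ((z.1, y₀ z.1), d z.1 • B z.1 z.2) (B z.1 z.2)) =O[𝓝 0] fun z => z.2 :=
      (isBigO_clm_apply hRQ.continuousAt).trans h1
    have h3 : Q =O[𝓝 0] fun z => ‖R ((z.1, y₀ z.1), d z.1 • B z.1 z.2) (B z.1 z.2)‖ *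
        ‖B z.1 z.2‖ := Asymptotics.isBigO_of_le _ fun z => by
      simpa using ContinuousLinearMap.le_opNorm _ (B z.1 z.2)
    simpa only [sq] using h3.trans (h2.norm_norm.mul h1.norm_norm)
  have hQ2 : Q =O[𝓝 0] fun z => ‖z‖ ^ 2 := hquad.trans
    ((Asymptotics.isBigO_of_le _ fun z => by simpa using norm_snd_le z).pow 2)
  obtain ⟨w, hw, hw0, hweq⟩ := exists_smooth_solution (g := fun x => -f x) hQ hQ2
    (Eventually.mono hf_smooth fun x hx => hx.neg) (by simp [hf_flat.apply_zero])
  -- `w` is flat, since `w = O(w + Q(x, w)) = O(f)`.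
  have hw_lim : Tendsto (fun x => (x, w x)) (𝓝 0) (𝓝 0) := tendsto_graph hw hw0
  have hw_flat : Flat w := by
    have h1 : (fun x => Q (x, w x)) =o[𝓝 0] w := by
      refine (hquad.comp_tendsto hw_lim).trans_isLittleO ?_
      have h2 : Tendsto w (𝓝 0) (𝓝 0) := by
        have := hw.continuousAt
        rwa [ContinuousAt, hw0] at this
      exact (Asymptotics.isLittleO_norm_pow_id one_lt_two).comp_tendsto h2
    have h3 : w =O[𝓝 0] f := by
      refine h1.right_isBigO_add.trans (Asymptotics.IsBigO.of_neg_right ?_)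
      refine EventuallyEq.isBigO ?_
      filter_upwards [hweq] with x hx
      rw [add_comm, hx]
    exact fun N => h3.trans (hf_flat N)
  have hBflat : Flat fun x => B x (w x) := fun N =>
    (isBigO_clm_apply hB.continuousAt).trans (hw_flat N)
  have hu : SmoothNear (fun x => d x • B x (w x)) 0 := hds.smul (hB.clm_apply hw)
  have hu_flat : Flat fun x => d x • B x (w x) := hBflat.smul hds.continuousAt
  refine ⟨fun x => d x • B x (w x), hu, hu_flat, ?_⟩
  have hylim : Tendsto (fun x => (x, y₀ x + d x • B x (w x))) (𝓝 0) (𝓝 0) :=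
    tendsto_graph (hy.add hu) (by simp [h0, hw0])
  filter_upwards [hylim.eventually hGF, hlim.eventually hGF.eventually_nhds, hweq,
    hdom.eventually_ne_zero] with x h1 h2 h3 h4
  have h5 : fderiv ℝ (fun y => G (x, y)) (y₀ x) = fderiv ℝ (fun y => F (x, y)) (y₀ x) := by
    refine EventuallyEq.fderiv_eq ?_
    have hc : Tendsto (fun y => (x, y)) (𝓝 (y₀ x)) (𝓝 (x, y₀ x)) :=
      (Continuous.prodMk_right x).tendsto _
    exact hc.eventually h2
  have h6 : F (x, y₀ x) = (d x * d x) • f x := by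
    rcases eq_or_ne (d x) 0 with h | h
    -- `d` may vanish at the origin only, where `F(x, y₀(x))` vanishes as well.
    · have hx : x = 0 := by
        by_contra hx
        exact h4 hx h
      rw [h, mul_zero, zero_smul, hx]
      exact hflat.apply_zero
    · rw [hf, smul_inv_smul₀ (mul_ne_zero h h)]
  have h7 : fderiv ℝ (fun y => F (x, y)) (y₀ x) (d x • B x (w x)) = (d x * d x) • w x := by
    rw [map_smul, hAB, smul_smul]
  have h8 : R ((x, y₀ x), d x • B x (w x)) (d x • B x (w x)) (d x • B x (w x)) =
      (d x * d x) • Q (x, w x) := by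
    simp only [hQdef, map_smul, smul_apply, smul_smul]
  rw [← h1, hRG, h5, h2.self_of_nhds, h6, h7, h8, ← smul_add, ← smul_add, add_assoc, h3,
    add_neg_cancel, smul_zero]

end Solution

end SmoothEq

theorem theorem5p3 (m n p : ℕ)
    (F : EuclideanSpace ℝ (Fin m) × EuclideanSpace ℝ (Fin n) → EuclideanSpace ℝ (Fin p))
    (hF : SmoothEq.SmoothNear F 0)
    (ŷ₀ : Fin n → MvPowerSeries (Fin m) ℝ)
    (hŷ₀ : SmoothEq.IsFormalSolution F ŷ₀)
    (y₀ : EuclideanSpace ℝ (Fin m) → EuclideanSpace ℝ (Fin n))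
    (hy₀ : SmoothEq.IsRealization ŷ₀ y₀) :
    (Ideal.span {SmoothEq.SmoothGerm.mk (SmoothEq.gramDet F y₀)
          (SmoothEq.smoothNear_gramDet hF hy₀.1 hy₀.2.1)} * SmoothEq.maxIdealInfty m =
        SmoothEq.maxIdealInfty m ↔
      SmoothEq.IsLojasiewicz (SmoothEq.gramDet F y₀)) ∧
    (Ideal.span {SmoothEq.SmoothGerm.mk (SmoothEq.gramDet F y₀)
          (SmoothEq.smoothNear_gramDet hF hy₀.1 hy₀.2.1)} * SmoothEq.maxIdealInfty m =
        SmoothEq.maxIdealInfty m →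
      ∃ y : EuclideanSpace ℝ (Fin m) → EuclideanSpace ℝ (Fin n),
        SmoothEq.IsRealization ŷ₀ y ∧
        ∀ᶠ x in 𝓝 (0 : EuclideanSpace ℝ (Fin m)), F (x, y x) = 0) := by
  have hs := SmoothEq.smoothNear_gramDet hF hy₀.1 hy₀.2.1
  refine ⟨⟨SmoothEq.isLojasiewicz_of_span_mul_maxIdealInfty hs, fun h =>
    SmoothEq.span_mul_maxIdealInfty_of_dominatesPow hs h.dominatesPow⟩, fun h => ?_⟩
  obtain ⟨u, hu, hflat, hsol⟩ := SmoothEq.exists_flat_correction hF hy₀.1 hy₀.2.1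
    (hŷ₀.flat hF hy₀) (SmoothEq.isLojasiewicz_of_span_mul_maxIdealInfty hs h).dominatesPow
  exact ⟨_, hy₀.add_flat hu hflat, hsol⟩
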